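/- Logarithms are base $2$, $[k]=\{0,\dots,k-1\}$, and binary strings are big-endian. Let $s\ge 2$, $l=\lceil\log s\rceil$, $\tilde s=2^{l}$, $n>l$, let $m$ be the largest power of two with $m\le n-l$, and let $C_0,\dots,C_{s-1}$ be distinct $n$-bit strings. The first $l$ of the $n$ system qubits form the subspace register, the other $n-l$ qubits the rest register; $|k\rangle|e_q\rangle$ has $k\in[2^l]$ in the subspace register and a single $1$, at qubit $q$, in the rest register. A state is in the subspace if its rest register is $|0\rangle$. *Gates and cost.* Circuits consist of X, CX, SWAP, Toffoli gates (controls may be negative), AND gates (a Toffoli gate onto an ancilla in state $|0\rangle$) and the measurement-based adjoint $\mathrm{AND}^\dagger$ (Hadamard and measurement of the target, CZ on the controls if the outcome is $1$, reset of the target). Toffoli and AND cost one Toffoli each, all other gates are free. The inverse of a circuit is obtained by reversing the order of its gates and exchanging AND and $\mathrm{AND}^\dagger$. *Partial unary iteration (PUI)* over an interval $I=\{a,\dots,b-1\}$ of subspace-register values, with target operations $U_i$, $i\in I$ (here: X on a rest qubit, or the identity): traverse the balanced binary tree of depth $l$ over $[2^l]$ from the root with a current control qubit (none at the root). At a node with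 address qubit $d$: if both halves meet $I$, recurse on the left and then on the right half, selecting them with $d$ itself (conjugated by X for the left half) if there is no control yet, and otherwise with a new ancilla computed by one AND of the control and the negated $d$, toggled by a CX from the control between the two halves, and uncomputed by $\mathrm{AND}^\dagger$; if only the right half meets $I$, select it likewise with $d$ or with an AND of the control and $d$; if only the left half meets $I$, the *restricted* PUI selects it likewise with negated $d$, whereas the *unrestricted* PUI ignores $d$ and recurses on the left half with the same control. At a leaf $i$ apply $U_i$ controlled on the current control (uncontrolled if there is none). *Algorithm.* Keep a tableau of the $s$ bit strings, initially $C_0,\dots,C_{s-1}$, to which every gate appended to the circuit $G$ (initially empty) is applied; integers $K=k=0$; and an empty batch of rows, $\beta$ denoting its current size. Repeat: 1. If $k=K+m$: if the batch is non-empty, append the unrestricted PUI over $\{K,\dots,k-1\}$ that zeroes the rest register of the batch rows (mapping $|i\rangle|e_q\rangle$ to $|i\rangle|0\rangle$ for the $q$-th batch row, with address $i$); empty the batch and set $K=k$. 2. Otherwise, if every row outside the batch is in the subspace: if the batch is non-empty, append the restricted PUI over $\{K,\dots,k-1\}$ that zeroes the batch rows. Each row $i$ now has some address $f(i)$ in its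 subspace register; return $G$ and $f$. 3. Otherwise, if $|k\rangle|0\rangle$ is in the tableau: increment $k$. 4. Otherwise, add a row to the batch. If some row $j$ outside the batch has a $1$ at a rest qubit $r\ge\beta$, take any such $j,r$ and, if $r\ne \beta$, append a SWAP of the rest qubits $r$ and $\beta$. If there is none, take any row $j$ that is neither in the batch nor in the subspace, any rest qubit $u<\beta$ at which row $j$ is $1$, and any qubit $v$ at which row $j$ differs from the batch row with content $e_u$, and append a Toffoli gate with target rest qubit $\beta$ and controls $u$ and $v$ (negative on $v$ if row $j$ is $0$ there). Then append CX gates controlled on rest qubit $\beta$ that map row $j$ to $|k\rangle|e_{\beta}\rangle$, append $j$ to the batch and increment $k$. **Theorem.** Whatever choices it makes, the algorithm never gets stuck, terminates, and returns a circuit $G$ and a map $f$ such that: - $f$ is a bijection from $[s]$ onto a subset of $[2^l]$; - $G$ acts on the $n$ system qubits and at most $\lceil\log s\rceil-1$ ancillas (every gate acting on pairwise different qubits); - with the ancillas starting and ending in $|0\rangle$ and for all measurement outcomes, $G$ maps $|C_i\rangle$ to $|f(i)\rangle|0\rangle$ for every $i\in[s]$ and the inverse circuit (the isometry) maps $\sum_i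 c_i|f(i)\rangle|0\rangle$ to $\sum_i c_i|C_i\rangle$ for all $c\in\mathbb C^s$ (up to the normalising factor $2^{-M/2}$, with $M$ the number of measurements in the respective circuit); - the Toffoli count of the inverse circuit is at most $$\left\lceil\frac sm\right\rceil\left(2m+\frac{\log(\tilde s/m)}2-3\right)+\log\!\left(\frac{\tilde s^{2}}m\right).$$ -/

import Mathlib

open scoped BigOperators

namespace SparseIso

/-! ### Circuits

Qubits are numbered by natural numbers.  In the isometry circuit the `n` system qubits are
`0, …, n - 1` (the first `⌈log s⌉` of them form the subspace register) and the ancilla qubits are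
`n, n + 1, …`.  A computational basis state assigns a bit to every qubit. -/

/-- Computational basis states. -/
abbrev Bits := ℕ → Bool

/-- A control: a qubit with the value (`true`: ordinary, `false`: negative control) that
activates it. -/
abbrev Ctrl := ℕ × Bool

/-- The control is active on the basis state `x`. -/
def active (x : Bits) (c : Ctrl) : Bool := x c.1 == c.2

/-- The elementary gates.  `andC c₁ c₂ t` is the AND gate, i.e. a Toffoli gate whose target `t` is
a newly allocated ancilla in state `|0⟩`; `andDag c₁ c₂ t` is its measurement-based adjoint, i.e. a
Hadamard gate on `t`, a measurement of `t`, a (classically controlled) CZ gate on the two controls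
if the outcome is `1`, and the release of `t`, which is again available as a `|0⟩` ancilla. -/
inductive Gate where
  | x (q : ℕ)
  | cx (c t : ℕ)
  | swap (a b : ℕ)
  | tof (c₁ c₂ : Ctrl) (t : ℕ)
  | andC (c₁ c₂ : Ctrl) (t : ℕ)
  | andDag (c₁ c₂ : Ctrl) (t : ℕ)

/-- The qubits on which a gate acts. -/
def Gate.wires : Gate → List ℕ
  | .x q => [q]
  | .cx c t => [c, t]
  | .swap a b => [a, b]
  | .tof c₁ c₂ t => [c₁.1, c₂.1, t]
  | .andC c₁ c₂ t => [c₁.1, c₂.1, t]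
  | .andDag c₁ c₂ t => [c₁.1, c₂.1, t]

/-- A gate must act on pairwise different qubits. -/
def Gate.WellFormed (g : Gate) : Prop := g.wires.Nodup

/-- The basis state to which a gate sends a basis state, up to a scalar factor. -/
def Gate.act : Gate → Bits → Bits
  | .x q, y => Function.update y q (!(y q))
  | .cx c t, y => Function.update y t (xor (y t) (y c))
  | .swap a b, y => fun q => y (Equiv.swap a b q)
  | .tof c₁ c₂ t, y => Function.update y t (xor (y t) (active y c₁ && active y c₂))
  | .andC c₁ c₂ t, y => Function.update y t (xor (y t) (active y c₁ && active y c₂))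
  | .andDag _ _ t, y => Function.update y t false

/-- The scalar factor that a basis state acquires under a gate, where `o` is the measurement
outcome (relevant for `andDag` only). For `andDag`, the Hadamard gate and the measurement yield
`(-1)^(o·t) / √2`, the CZ correction yields `(-1)^(o·c₁·c₂)`. -/
noncomputable def Gate.factor : Gate → Bool → Bits → ℂ
  | .andDag c₁ c₂ t, o, y =>
      (if o && xor (y t) (active y c₁ && active y c₂) then -1 else 1) * ((Real.sqrt 2)⁻¹ : ℝ)
  | _, _, _ => 1

/-- (Unnormalised) state vectors: finite linear combinations of basis states. -/
abbrev Ket := Bits →₀ ℂ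

/-- The basis vector `|x⟩`. -/
noncomputable def ket (x : Bits) : Ket := Finsupp.single x 1

/-- The linear operator that a gate applies to a state vector when the measurement outcome is `o`
(the Kraus operator of that outcome for `andDag`, a unitary not depending on `o` otherwise). -/
noncomputable def Gate.op (g : Gate) (o : Bool) : Ket →ₗ[ℂ] Ket :=
  Finsupp.linearCombination ℂ fun x => g.factor o x • ket (g.act x)

/-- Circuits: lists of gates, in the order in which they are applied. -/
abbrev Circuit := List Gate

/-- The qubit-level action of a circuit on basis states (up to scalar factors). -/
def act (G : Circuit) (y : Bits) : Bits := G.foldl (fun z g => g.act z) y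

/-- The operator of a circuit, given the outcome `o t` of a measurement made by the `t`-th gate. -/
noncomputable def run : Circuit → (ℕ → Bool) → Ket →ₗ[ℂ] Ket
  | [], _ => LinearMap.id
  | g :: G, o => run G (fun t => o (t + 1)) ∘ₗ g.op (o 0)

/-- The adjoint of a gate. -/
def Gate.dagger : Gate → Gate
  | .andC c₁ c₂ t => .andDag c₁ c₂ t
  | .andDag c₁ c₂ t => .andC c₁ c₂ t
  | g => g

/-- The inverse circuit. -/
def inverse (G : Circuit) : Circuit := (G.map Gate.dagger).reverse

/-- Toffoli gates needed for a gate: Toffoli gates and AND gates cost one each; the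
measurement-based adjoint of AND and all the other gates are free. -/
def Gate.toffolis : Gate → ℕ
  | .tof _ _ _ => 1
  | .andC _ _ _ => 1
  | _ => 0

/-- The Toffoli count of a circuit. -/
def toffolis (G : Circuit) : ℕ := (G.map Gate.toffolis).sum

/-- Number of measurements made by a gate. -/
def Gate.measurements : Gate → ℕ
  | .andDag _ _ _ => 1
  | _ => 0

/-- Number of measurements in a circuit. -/
def measurements (G : Circuit) : ℕ := (G.map Gate.measurements).sum

/-! ### Partial unary iteration -/

/-- The (controlled) target operation at a leaf: `U i = some t` stands for an X gate on qubit `t`,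
`U i = none` for the identity. -/
def leaf (U : ℕ → Option ℕ) (control : Option ℕ) (i : ℕ) : Circuit :=
  match U i, control with
  | none, _ => []
  | some t, none => [.x t]
  | some t, some c => [.cx c t]

/-- The partial unary iteration over the address interval `{lo, …, hi - 1}`, for the address
register consisting of the qubits `0, …, w - 1` (big-endian): the recursion at the tree node with
the addresses `{i, …, i + 2 ^ r - 1}`, which branches on the address qubit `d = w - r`.
Here `control` is the current control qubit, if there is one, and `a` is the number of ancillas in
use, so that `n + a` is the next ancilla.  The unrestricted version (`restricted = false`) ignores
the address qubit `d` if only the left half of the node meets the interval. -/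
def puiNode (restricted : Bool) (n w lo hi : ℕ) (U : ℕ → Option ℕ) :
    (r i a : ℕ) → (control : Option ℕ) → Circuit
  | 0, i, _, control => leaf U control i
  | r + 1, i, a, control =>
    let d := w - (r + 1)
    let rec' := puiNode restricted n w lo hi U r
    if lo < i + 2 ^ r ∧ i < hi then
      if lo < i + 2 ^ r + 2 ^ r ∧ i + 2 ^ r < hi then
        -- both halves meet the interval
        match control with
        | some c =>
          [.andC (c, true) (d, false) (n + a)] ++ rec' i (a + 1) (some (n + a)) ++
          [.cx c (n + a)] ++ rec' (i + 2 ^ r) (a + 1) (some (n + a)) ++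
          [.andDag (c, true) (d, true) (n + a)]
        | none =>
          [.x d] ++ rec' i a (some d) ++ [.x d] ++ rec' (i + 2 ^ r) a (some d)
      else if restricted then
        -- only the left half meets the interval
        match control with
        | some c =>
          [.andC (c, true) (d, false) (n + a)] ++ rec' i (a + 1) (some (n + a)) ++
          [.andDag (c, true) (d, false) (n + a)]
        | none => [.x d] ++ rec' i a (some d) ++ [.x d]
      else rec' i a control
    else
      -- only the right half meets the interval
      match control with
      | some c =>
        [.andC (c, true) (d, true) (n + a)] ++ rec' (i + 2 ^ r) (a + 1) (some (n + a)) ++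
        [.andDag (c, true) (d, true) (n + a)]
      | none => rec' (i + 2 ^ r) a (some d)

/-- The (un)restricted partial unary iteration over the address interval `{lo, …, hi - 1}`,
`lo < hi ≤ 2 ^ w`. -/
def pui (restricted : Bool) (n w lo hi : ℕ) (U : ℕ → Option ℕ) : Circuit :=
  puiNode restricted n w lo hi U w 0 0 none

/-! ### The algorithm that finds the isometry circuit -/

/-- `⌈log₂ s⌉`, the size of the subspace register. -/
def subBits (s : ℕ) : ℕ := Nat.clog 2 s

/-- `m`, the largest power of two that is at most `n - ⌈log₂ s⌉`. -/
def batchSize (n s : ℕ) : ℕ := 2 ^ Nat.log 2 (n - subBits s)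

theorem batchSize_isGreatest (n s : ℕ) (h : subBits s < n) :
    IsGreatest {m : ℕ | (∃ p, m = 2 ^ p) ∧ m ≤ n - subBits s} (batchSize n s) := by
  refine ⟨⟨⟨_, rfl⟩, Nat.pow_log_le_self 2 (by omega)⟩, ?_⟩
  rintro _ ⟨⟨p, rfl⟩, hp⟩
  exact Nat.pow_le_pow_right (by norm_num) (Nat.le_log_of_pow_le (by norm_num) hp)

/-- `n`-bit strings as basis states; all the ancillas are `0`. -/
def extend {n : ℕ} (x : Fin n → Bool) : Bits := fun q => if h : q < n then x ⟨q, h⟩ else false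

/-- The basis state `|k⟩|0⟩` with `k` in the `l`-qubit subspace register (big-endian). -/
def subKet (l k : ℕ) : Bits := fun q => decide (q < l) && k.testBit (l - 1 - q)

/-- The basis state `|k⟩|e_b⟩`. -/
def batchKet (l k b : ℕ) : Bits := Function.update (subKet l k) (l + b) true

/-- The number in the `l`-qubit subspace register (big-endian). -/
def address (l : ℕ) (x : Bits) : ℕ := ∑ q ∈ Finset.range l, (x q).toNat * 2 ^ (l - 1 - q)

/-- The state lies in the subspace: all the qubits outside the subspace register are `0`. -/
def InSubspace (l : ℕ) (x : Bits) : Prop := ∀ q, l ≤ q → x q = false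

/-- The multi-target CX gate with the given control that changes the row `x` into `y`
(when `x` and `y` are `1` at the control). -/
def cmx (n control : ℕ) (x y : Bits) : Circuit :=
  ((List.range n).filter fun q => q ≠ control ∧ x q ≠ y q).map fun q => .cx control q

/-- The variables of the algorithm: the current tableau, the circuit found so far, the first
address `start` of the current block `{start, …, start + m - 1}` of addresses, the runner `k`
through that block, and the current batch: its `q`-th entry `(j, i)` means that row `j` of the
tableau is `|i⟩|e_q⟩`. -/
structure AlgState (s : ℕ) where
  tab : Fin s → Bits
  circ : Circuit
  start : ℕ
  k : ℕ
  batch : List (Fin s × ℕ)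

namespace AlgState

variable {s : ℕ}

/-- The state at the beginning of the algorithm. -/
def initial {n : ℕ} (C : Fin s → Fin n → Bool) : AlgState s where
  tab := fun i => extend (C i)
  circ := []
  start := 0
  k := 0
  batch := []

/-- The row `j` is in the current batch. -/
def InBatch (c : AlgState s) (j : Fin s) : Prop := ∃ i, (j, i) ∈ c.batch

/-- The row `j` is neither in the current batch nor in the subspace. -/
def Pending (c : AlgState s) (j : Fin s) : Prop :=
  ¬ c.InBatch j ∧ ¬ InSubspace (subBits s) (c.tab j)

/-- Append a circuit and update the tableau. -/
def append (c : AlgState s) (P : Circuit) : AlgState s :=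
  { c with tab := fun i => act P (c.tab i), circ := c.circ ++ P }

/-- The target operations for zeroing the batch: if the `q`-th element of the batch has the address
`i`, then `U i` is the X gate on the `q`-th qubit outside the subspace register. -/
def zeroing (c : AlgState s) (i : ℕ) : Option ℕ :=
  (c.batch.findIdx? fun e => e.2 == i).map fun q => subBits s + q

/-- The partial unary iteration over the addresses `{start, …, k - 1}` that zeroes the batch. -/
def zeroBatch (c : AlgState s) (restricted : Bool) (n : ℕ) : Circuit :=
  if c.batch = [] then [] else pui restricted n (subBits s) c.start c.k c.zeroing

/-- Apply the circuit `pre`, after which row `j` has a `1` at qubit `⌈log s⌉ + b`, with `b` the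
size of the batch; then map row `j` to `|k⟩|e_b⟩` and add it to the batch. -/
def add (c : AlgState s) (n : ℕ) (pre : Circuit) (j : Fin s) : AlgState s :=
  let b := c.batch.length
  let P := pre ++ cmx n (subBits s + b) (act pre (c.tab j)) (batchKet (subBits s) c.k b)
  { c.append P with k := c.k + 1, batch := c.batch ++ [(j, c.k)] }

/-- Another element has to be added to the batch: the block of addresses is not exhausted, and
there are rows that are neither in the batch nor in the subspace. -/
def Building (c : AlgState s) (n : ℕ) : Prop :=
  c.k ≠ c.start + batchSize n s ∧ ∃ j, c.Pending j

/-- The address `k` is present in the subspace, i.e. `|k⟩|0⟩` is in the tableau. -/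
def Occupied (c : AlgState s) : Prop := ∃ i, c.tab i = subKet (subBits s) c.k

/-- One iteration of the main loop (not the last one).  The algorithm may make any of the choices
(of `j`, `r`, `u` and `v`) that are permitted here. -/
inductive Step (n : ℕ) : AlgState s → AlgState s → Prop
  /-- The block of addresses is exhausted: zero the batch with an unrestricted partial unary
  iteration and start a new batch. -/
  | close (c : AlgState s) (h : c.k = c.start + batchSize n s) :
      Step n c { c.append (c.zeroBatch false n) with start := c.k, batch := [] }
  /-- The address `k` is already present in the subspace: leave it alone. -/
  | skip (c : AlgState s) (h : c.Building n) (hk : c.Occupied) :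
      Step n c { c with k := c.k + 1 }
  /-- Some row outside the batch has a `1` at a qubit `r ≥ ⌈log s⌉ + b`, which is swapped with
  the qubit `⌈log s⌉ + b`. -/
  | addSwap (c : AlgState s) (h : c.Building n) (hk : ¬ c.Occupied)
      (j : Fin s) (hj : ¬ c.InBatch j) (r : ℕ) (hr : subBits s + c.batch.length ≤ r) (hrn : r < n)
      (hjr : c.tab j r = true) :
      Step n c (c.add n (if r = subBits s + c.batch.length then []
        else [.swap r (subBits s + c.batch.length)]) j)
  /-- There is no such row: use a Toffoli gate with the target `⌈log s⌉ + b` to create one.  Its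
  controls are a qubit `u` with `⌈log s⌉ ≤ u < ⌈log s⌉ + b` at which row `j` is `1`, and a qubit `v`
  at which row `j` differs from the element `e.1` of the batch with the content `e_(u - ⌈log s⌉)`;
  the latter control is negative if row `j` is `0` at `v`. -/
  | addToffoli (c : AlgState s) (h : c.Building n) (hk : ¬ c.Occupied)
      (hno : ∀ i, ¬ c.InBatch i → ∀ r, subBits s + c.batch.length ≤ r → r < n → c.tab i r = false)
      (j : Fin s) (hj : c.Pending j) (u : ℕ) (hu : subBits s ≤ u) (hju : c.tab j u = true)
      (e : Fin s × ℕ) (he : c.batch[u - subBits s]? = some e)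
      (v : ℕ) (hv : v < n) (hjv : c.tab j v ≠ c.tab e.1 v) :
      Step n c (c.add n [.tof (u, true) (v, c.tab j v) (subBits s + c.batch.length)] j)

/-- The last iteration of the main loop: if the block of addresses is not exhausted and all the
rows are in the batch or in the subspace, then zero the batch with a restricted partial unary
iteration and return the circuit `G` and the map `f`, which is read off from the tableau. -/
def Returns (n : ℕ) (c : AlgState s) (G : Circuit) (f : Fin s → ℕ) : Prop :=
  c.k ≠ c.start + batchSize n s ∧ (∀ j, ¬ c.Pending j) ∧
    G = (c.append (c.zeroBatch true n)).circ ∧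
    ∀ i, f i = address (subBits s) ((c.append (c.zeroBatch true n)).tab i)

end AlgState

end SparseIso

/-! The quantum part reduces to one observation. On basis states the gates act as maps of bit
strings. If every AND finds its target at 0, and every AND† finds in its target the conjunction of
its controls (`Valid`), the signs from measurement and correction cancel. A circuit then contributes
only a power of 1/√2 that depends neither on the state nor on the outcomes (`Valid.run_ket`).
Validity passes to the inverse (`Valid.inverse`) and linearity handles superpositions, so the rest
concerns bit strings.

Partial unary iteration flips the target of the leaf it selects (`pui_flips`). An address in the
interval selects itself. Any other address selects nothing in the restricted version; in the
unrestricted one this is guaranteed only below the interval.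

`AlgState.Invariant` says that batch rows are |i⟩|e_q⟩ with distinct addresses i, that no row is
|i⟩|0⟩ for such an i, and that each address below `k` belongs to a row that is not pending. Counting
gives `k < s` while a row is pending. Zeroing settles the batch and keeps the subspace rows below
`k`; those above may be spoiled and treated again, except at the end, where the restricted version
protects them. Reversibility keeps rows distinct, which supplies the Toffoli control `v`; `start +
k` grows and is at most `2 * s`.

For the count, write m = 2^p and l = ⌈log s⌉. A block needs at most m - 1 Toffolis to build its
batch and `ones e j + m - 2` to zero it, where j is its index and e = l - p. The first B indices
have at most B * e / 2 binary ones in total (`two_mul_sum_ones_le`). The last, restricted iteration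
exceeds its block's budget by at most l - 1, and the truncated subtraction in the first block costs
at most 1; together this is l ≤ 2l - p. If p > l there is a single block, estimated directly. -/

namespace SparseIso

/-! ### Circuits as reversible maps of bit strings -/

/-- The gate acts on the basis state `y` without loss of information: the target of an AND gate is
`|0⟩`, and the target of its adjoint holds the conjunction of the controls. -/
def Gate.Ok (g : Gate) (y : Bits) : Prop :=
  g.WellFormed ∧
    match g with
    | .andC _ _ t => y t = false
    | .andDag c₁ c₂ t => y t = (active y c₁ && active y c₂)
    | _ => True

/-- All the gates of the circuit act without loss of information when it is applied to `y`. -/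
def Valid : Circuit → Bits → Prop
  | [], _ => True
  | g :: G, y => g.Ok y ∧ Valid G (g.act y)

@[simp] theorem act_nil (y : Bits) : act [] y = y := rfl

@[simp] theorem act_cons (g : Gate) (G : Circuit) (y : Bits) :
    act (g :: G) y = act G (g.act y) := rfl

@[simp] theorem act_append (G H : Circuit) (y : Bits) : act (G ++ H) y = act H (act G y) := by
  simp [act, List.foldl_append]

@[simp] theorem valid_nil (y : Bits) : Valid [] y := trivial

@[simp] theorem valid_cons (g : Gate) (G : Circuit) (y : Bits) :
    Valid (g :: G) y ↔ g.Ok y ∧ Valid G (g.act y) := Iff.rfl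

theorem valid_append (G H : Circuit) (y : Bits) :
    Valid (G ++ H) y ↔ Valid G y ∧ Valid H (act G y) := by
  induction G generalizing y with
  | nil => simp
  | cons g G ih => simp [ih, and_assoc]

theorem inverse_append (G H : Circuit) : inverse (G ++ H) = inverse H ++ inverse G := by
  simp [inverse]

theorem inverse_cons (g : Gate) (G : Circuit) : inverse (g :: G) = inverse G ++ [g.dagger] := by
  simp [inverse]

theorem Gate.WellFormed.dagger {g : Gate} (h : g.WellFormed) : g.dagger.WellFormed := by
  cases g <;> exact h

theorem active_update {y : Bits} {t : ℕ} {b : Bool} {c : Ctrl} (h : c.1 ≠ t) :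
    active (Function.update y t b) c = active y c := by
  simp [active, Function.update_of_ne h]

theorem Gate.Ok.dagger {g : Gate} {y : Bits} (h : g.Ok y) :
    g.dagger.Ok (g.act y) ∧ g.dagger.act (g.act y) = y := by
  refine ⟨⟨h.1.dagger, ?_⟩, ?_⟩
  · obtain ⟨hw, h⟩ := h
    cases g <;> simp_all [Gate.dagger, Gate.act, Gate.WellFormed, Gate.wires, active_update]
  · obtain ⟨hw, h⟩ := h
    cases g <;> simp_all [Gate.dagger, Gate.act, Gate.WellFormed, Gate.wires, active_update]

theorem Valid.inverse {G : Circuit} {y : Bits} (h : Valid G y) :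
    Valid (inverse G) (act G y) ∧ act (inverse G) (act G y) = y := by
  induction G generalizing y with
  | nil => exact ⟨trivial, rfl⟩
  | cons g G ih =>
    obtain ⟨h₁, h₂⟩ := h
    obtain ⟨h₃, h₄⟩ := ih h₂
    have h₅ := h₁.dagger
    rw [inverse_cons, valid_append, act_append, act_cons, h₄]
    simpa [h₃] using h₅

theorem Valid.act_injective {G : Circuit} {x y : Bits} (hx : Valid G x) (hy : Valid G y)
    (h : act G x = act G y) : x = y := by
  rw [← hx.inverse.2, ← hy.inverse.2, h]

theorem Gate.op_ket (g : Gate) (o : Bool) (y : Bits) :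
    g.op o (ket y) = g.factor o y • ket (g.act y) := by
  simp [Gate.op, ket]

/-- The sign of AND† is (-1) to the power o·(t + c₁c₂), which is 1 when the target holds the
conjunction of the controls. Only the 1/√2 of the measurement survives. -/
theorem Gate.Ok.factor_eq {g : Gate} {y : Bits} (h : g.Ok y) (o : Bool) :
    g.factor o y = (((Real.sqrt 2)⁻¹ : ℝ) : ℂ) ^ g.measurements := by
  obtain ⟨_, h⟩ := h
  cases g <;> simp_all [Gate.factor, Gate.measurements]

theorem Valid.run_ket {G : Circuit} {y : Bits} (h : Valid G y) (o : ℕ → Bool) :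
    run G o (ket y) = (((Real.sqrt 2)⁻¹ : ℝ) : ℂ) ^ measurements G • ket (act G y) := by
  induction G generalizing y o with
  | nil => simp [run, measurements]
  | cons g G ih =>
    rw [run, LinearMap.comp_apply, Gate.op_ket, map_smul, ih h.2, h.1.factor_eq, smul_smul,
      ← pow_add]
    simp [measurements]

/-- The Toffoli count of the inverse circuit. -/
def cost (G : Circuit) : ℕ := toffolis (inverse G)

theorem cost_append (G H : Circuit) : cost (G ++ H) = cost G + cost H := by
  simp [cost, inverse_append, toffolis, add_comm]

theorem cost_cons (g : Gate) (G : Circuit) : cost (g :: G) = g.dagger.toffolis + cost G := by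
  simp [cost, inverse_cons, toffolis, add_comm]

@[simp] theorem cost_nil : cost [] = 0 := rfl

/-! ### Addresses -/

/-- The number in the last `r` qubits of the `w`-qubit subspace register. -/
def lowAddress (w r : ℕ) (y : Bits) : ℕ := ∑ t ∈ Finset.range r, (y (w - 1 - t)).toNat * 2 ^ t

theorem lowAddress_succ (w r : ℕ) (y : Bits) :
    lowAddress w (r + 1) y = lowAddress w r y + (y (w - (r + 1))).toNat * 2 ^ r := by
  rw [lowAddress, Finset.sum_range_succ, show w - 1 - r = w - (r + 1) by omega]; rfl

theorem address_eq_lowAddress (w : ℕ) (y : Bits) : address w y = lowAddress w w y := by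
  rw [address, ← Finset.sum_range_reflect]
  refine Finset.sum_congr rfl fun t ht => ?_
  have := Finset.mem_range.1 ht
  rw [show w - 1 - (w - 1 - t) = t by omega]

theorem lowAddress_lt (w r : ℕ) (y : Bits) : lowAddress w r y < 2 ^ r := by
  induction r with
  | zero => simp [lowAddress]
  | succ r ih =>
    rw [lowAddress_succ, pow_succ]
    cases y (w - (r + 1)) <;> simp <;> omega

theorem address_lt (w : ℕ) (y : Bits) : address w y < 2 ^ w :=
  address_eq_lowAddress w y ▸ lowAddress_lt w w y

theorem testBit_lowAddress (w r : ℕ) (y : Bits) {t : ℕ} (ht : t < r) :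
    (lowAddress w r y).testBit t = y (w - 1 - t) := by
  induction r with
  | zero => omega
  | succ r ih =>
    rw [lowAddress_succ, add_comm, mul_comm, Nat.testBit_two_pow_mul_add _ (lowAddress_lt w r y)]
    split_ifs with h
    · exact ih h
    · obtain rfl : t = r := by omega
      rw [show w - (t + 1) = w - 1 - t by omega]
      cases y (w - 1 - t) <;> simp

theorem testBit_address {w q : ℕ} (y : Bits) (hq : q < w) :
    (address w y).testBit (w - 1 - q) = y q := by
  rw [address_eq_lowAddress, testBit_lowAddress w w y (by omega)]
  congr 1; omega

theorem address_congr {w : ℕ} {x y : Bits} (h : ∀ q < w, x q = y q) :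
    address w x = address w y :=
  Finset.sum_congr rfl fun q hq => by rw [h q (Finset.mem_range.1 hq)]

theorem address_subKet {l k : ℕ} (hk : k < 2 ^ l) : address l (subKet l k) = k := by
  refine Nat.eq_of_testBit_eq fun t => ?_
  by_cases ht : t < l
  · have := testBit_address (subKet l k) (show l - 1 - t < l by omega)
    rw [show l - 1 - (l - 1 - t) = t by omega] at this
    rw [this]
    simp only [subKet, show l - 1 - (l - 1 - t) = t by omega]
    simp; omega
  · rw [Nat.testBit_lt_two_pow, Nat.testBit_lt_two_pow]
    · exact hk.trans_le (Nat.pow_le_pow_right (by norm_num) (by omega))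
    · exact (address_lt _ _).trans_le (Nat.pow_le_pow_right (by norm_num) (by omega))

theorem InSubspace.eq_subKet {l : ℕ} {x : Bits} (h : InSubspace l x) :
    x = subKet l (address l x) := by
  funext q
  by_cases hq : q < l
  · simp [subKet, hq, testBit_address x hq]
  · simp [subKet, hq, h q (by omega)]

theorem inSubspace_subKet (l k : ℕ) : InSubspace l (subKet l k) := fun q hq => by
  simp [subKet]; omega

theorem address_batchKet {l k b : ℕ} (hk : k < 2 ^ l) : address l (batchKet l k b) = k := by
  rw [← address_subKet hk]
  refine address_congr fun q hq => ?_
  rw [batchKet, Function.update_of_ne (by omega), address_subKet hk]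

theorem batchKet_rest {l k b q : ℕ} (hq : l ≤ q) : batchKet l k b q = decide (q = l + b) := by
  by_cases h : q = l + b
  · subst h; simp [batchKet]
  · simp [batchKet, h, subKet]; omega

/-! ### The action of the partial unary iteration -/

/-- The basis state `y` with the given qubit, if any, flipped. -/
def flipAt (y : Bits) : Option ℕ → Bits
  | none => y
  | some t => Function.update y t (!(y t))

/-- The leaf that the partial unary iteration selects for the basis state `y`, below the node with
the addresses `{i, …, i + 2 ^ r - 1}`. -/
def selected (restricted : Bool) (w lo hi : ℕ) (y : Bits) : (r i : ℕ) → Option ℕ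
  | 0, i => some i
  | r + 1, i =>
    if lo < i + 2 ^ r ∧ i < hi then
      if lo < i + 2 ^ r + 2 ^ r ∧ i + 2 ^ r < hi then
        if y (w - (r + 1)) then selected restricted w lo hi y r (i + 2 ^ r)
        else selected restricted w lo hi y r i
      else if restricted then
        if y (w - (r + 1)) then none else selected restricted w lo hi y r i
      else selected restricted w lo hi y r i
    else if y (w - (r + 1)) then selected restricted w lo hi y r (i + 2 ^ r) else none

/-- This covers both versions: where the unrestricted one ignores an address qubit, the interval
misses the right half, so that qubit is 0 for an address in the interval. -/
theorem selected_eq_some {restricted : Bool} {w lo hi : ℕ} {y : Bits} {r i : ℕ}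
    (h₁ : lo ≤ i + lowAddress w r y) (h₂ : i + lowAddress w r y < hi) :
    selected restricted w lo hi y r i = some (i + lowAddress w r y) := by
  induction r generalizing i with
  | zero => simp [selected, lowAddress]
  | succ r ih =>
    have hlt := lowAddress_lt w r y
    rw [lowAddress_succ] at h₁ h₂ ⊢
    rw [selected]
    cases hd : y (w - (r + 1)) <;> simp only [hd, Bool.toNat_true, Bool.toNat_false, one_mul,
      zero_mul, add_zero, ← add_assoc] at h₁ h₂ ⊢
    · rw [if_pos (by omega), ih h₁ h₂]
      simp
    · rw [add_right_comm] at h₁ h₂ ⊢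
      rw [ih h₁ h₂]
      by_cases hl : lo < i + 2 ^ r ∧ i < hi
      · rw [if_pos hl, if_pos (by omega)]; simp [add_right_comm]
      · rw [if_neg hl]; simp [add_right_comm]

theorem selected_restricted_eq_none {w lo hi : ℕ} {y : Bits} {r i : ℕ}
    (hlh : lo < hi) (hlo : lo < i + 2 ^ r) (hhi : i < hi)
    (h : i + lowAddress w r y < lo ∨ hi ≤ i + lowAddress w r y) :
    selected true w lo hi y r i = none := by
  induction r generalizing i with
  | zero => simp [lowAddress] at h hlo; omega
  | succ r ih =>
    have hlt := lowAddress_lt w r y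
    rw [lowAddress_succ] at h
    rw [pow_succ] at hlo
    rw [selected]
    cases hd : y (w - (r + 1)) <;> simp only [hd, Bool.toNat_true, Bool.toNat_false, one_mul,
      zero_mul, add_zero] at h ⊢
    · by_cases hl : lo < i + 2 ^ r ∧ i < hi
      · rw [if_pos hl, ih hl.1 hl.2 h]; simp
      · rw [if_neg hl]; simp
    · by_cases hl : lo < i + 2 ^ r ∧ i < hi
      · rw [if_pos hl]
        by_cases hr : lo < i + 2 ^ r + 2 ^ r ∧ i + 2 ^ r < hi
        · rw [if_pos hr, ih hr.1 hr.2 (by omega)]; simp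
        · rw [if_neg hr]; simp
      · rw [if_neg hl, ih (by omega) (by omega) (by omega)]; simp

/-- Ignored qubits can only lower an address: it is read as if these qubits were 0. An address below
the interval leaves the visited part of the tree at a node where only the right half is visited. No
such claim holds above the interval. -/
theorem selected_unrestricted_eq_none {w lo hi : ℕ} {y : Bits} {r i : ℕ}
    (hlh : lo < hi) (hlo : lo < i + 2 ^ r) (hhi : i < hi) (h : i + lowAddress w r y < lo) :
    selected false w lo hi y r i = none := by
  induction r generalizing i with
  | zero => simp at hlo; omega
  | succ r ih =>
    have hlt := lowAddress_lt w r y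
    rw [lowAddress_succ] at h
    rw [pow_succ] at hlo
    rw [selected]
    cases hd : y (w - (r + 1)) <;> simp only [hd, Bool.toNat_true, Bool.toNat_false, one_mul,
      zero_mul, add_zero] at h ⊢
    · by_cases hl : lo < i + 2 ^ r ∧ i < hi
      · rw [if_pos hl, ih hl.1 hl.2 h]; simp
      · rw [if_neg hl]; simp
    · rw [if_neg (by omega), ih (by omega) (by omega) (by omega)]; simp

/-- The value of a control, which is `true` if there is none. -/
def controlValue (y : Bits) : Option ℕ → Bool
  | none => true
  | some c => y c

/-- The target is a qubit between `w` and `n`. -/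
def TargetOk (w n : ℕ) (T : Option ℕ) : Prop := ∀ t, T = some t → w ≤ t ∧ t < n

/-- The basis state `y` with the target flipped if the condition holds. -/
def flipIf (b : Bool) (T : Option ℕ) (y : Bits) : Bits := flipAt y (if b then T else none)

@[simp] theorem flipIf_false (T : Option ℕ) (y : Bits) : flipIf false T y = y := rfl

@[simp] theorem flipIf_none (b : Bool) (y : Bits) : flipIf b none y = y := by
  cases b <;> rfl

theorem TargetOk.flipIf_apply {w n : ℕ} {T : Option ℕ} (h : TargetOk w n T) (b : Bool) (y : Bits)
    {q : ℕ} (hq : q < w ∨ n ≤ q) : flipIf b T y q = y q := by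
  cases b
  · rfl
  · cases T with
    | none => rfl
    | some t => exact Function.update_of_ne (by have := h t rfl; omega) _ _

theorem TargetOk.flipIf_update {w n : ℕ} {T : Option ℕ} (h : TargetOk w n T) (b : Bool) (y : Bits)
    {q : ℕ} (hq : q < w ∨ n ≤ q) (e : Bool) :
    flipIf b T (Function.update y q e) = Function.update (flipIf b T y) q e := by
  cases b
  · rfl
  · cases T with
    | none => rfl
    | some t =>
      have : t ≠ q := by have := h t rfl; omega
      simp only [flipIf, flipAt, if_true, Function.update_of_ne this]
      rw [Function.update_comm this]

/-- Below a node of height `r` of the tree with control `control`, with the qubits from `N` on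
unused, the circuit flips the target `T` for the basis states that have the same lower address
qubits as `y` and are active at the control. -/
def Flips (G : Circuit) (w r N : ℕ) (control T : Option ℕ) (y : Bits) : Prop :=
  ∀ z : Bits, (∀ q, w - r ≤ q → q < w → z q = y q) → (∀ q, N ≤ q → z q = false) →
    Valid G z ∧ act G z = flipIf (controlValue z control) T z

theorem leaf_flips {w n N i : ℕ} {U : ℕ → Option ℕ} {control : Option ℕ}
    (hU : ∀ i, TargetOk w n (U i)) (hc : ∀ c, control = some c → c < w ∨ n ≤ c) (y : Bits) :
    Flips (leaf U control i) w 0 N control (U i) y := by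
  intro z _ _
  cases hi : U i with
  | none => simp [leaf, hi]
  | some t =>
    cases control with
    | none =>
      simp [leaf, hi, flipIf, flipAt, Gate.Ok, Gate.WellFormed, Gate.wires, Gate.act, controlValue]
    | some c =>
      have := hU i t hi
      have hct : c ≠ t := by have := hc c rfl; omega
      cases hy : z c <;>
        simp [leaf, hi, flipIf, flipAt, Gate.Ok, Gate.WellFormed, Gate.wires, Gate.act,
          controlValue, hct, hy]

/-- The target lies outside the address register and the ancillas, so `A` changes neither the
controls nor qubit `N`. The final AND† therefore still finds the conjunction that the AND computed.
-/
theorem flips_and {w n r N c : ℕ} {A : Circuit} {T : Option ℕ} {y : Bits} (v : Bool)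
    (hr : r < w) (hwn : w ≤ n) (hN : n ≤ N) (hc : c < w - (r + 1) ∨ n ≤ c ∧ c < N)
    (hT : TargetOk w n T) (hA : Flips A w r (N + 1) (some N) T y) :
    Flips ([.andC (c, true) (w - (r + 1), v) N] ++ A ++ [.andDag (c, true) (w - (r + 1), v) N])
      w (r + 1) N (some c) (if y (w - (r + 1)) = v then T else none) y := by
  intro z hz hz0
  set d := w - (r + 1) with hd
  have hdz : z d = y d := hz d le_rfl (by omega)
  have hcd : c ≠ d := by omega
  have hcN : c ≠ N := by omega
  have hdN : d ≠ N := by omega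
  have hfc := fun b x => hT.flipIf_apply b x (q := c) (by omega)
  have hfd := fun b x => hT.flipIf_apply b x (q := d) (by omega)
  have hfN := fun b x => hT.flipIf_apply b x (q := N) (by omega)
  have hfu := fun b x => hT.flipIf_update b x (q := N) (by omega)
  have hzN : z N = false := hz0 N le_rfl
  obtain ⟨h₁, h₂⟩ := hA (Function.update z N (z c && (y d == v)))
    (fun q hq hq' => by rw [Function.update_of_ne (by omega)]; exact hz q (by omega) hq')
    (fun q hq => by rw [Function.update_of_ne (by omega)]; exact hz0 q (by omega))
  have h₀ : (Gate.andC (c, true) (d, v) N).act z =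
      Function.update z N (z c && (y d == v)) := by
    simp [Gate.act, hzN, active, hdz]
  simp only [controlValue, Function.update_self] at h₂
  simp only [List.cons_append, List.nil_append, valid_cons, h₀, act_cons, valid_append, act_append,
    h₁, h₂, true_and, act_nil, valid_nil, and_true, hfu]
  simp only [Gate.Ok, Gate.WellFormed, Gate.wires, Gate.act, Function.update_self, active,
    Function.update_of_ne hcN, Function.update_of_ne hdN, hfc, hfd, hzN, hdz,
    Function.update_idem, controlValue]
  refine ⟨by simp [hcd, hcN, hdN], ?_⟩
  have : ∀ b, Function.update (flipIf b T z) N false = flipIf b T z := fun b => by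
    rw [Function.update_eq_self_iff, hfN, hzN]
  rw [this]
  by_cases h : y d = v
  · simp [h]
  · simp [h, beq_eq_false_iff_ne.2 h]

/-- The CX turns c ∧ ¬d into c ∧ d, since (c ∧ ¬d) xor c = c ∧ d. Hence the closing AND† has a
positive control on d although the AND had a negative one. -/
theorem flips_and_both {w n r N c : ℕ} {A B : Circuit} {T S : Option ℕ} {y : Bits}
    (hr : r < w) (hwn : w ≤ n) (hN : n ≤ N) (hc : c < w - (r + 1) ∨ n ≤ c ∧ c < N)
    (hT : TargetOk w n T) (hA : Flips A w r (N + 1) (some N) T y)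
    (hS : TargetOk w n S) (hB : Flips B w r (N + 1) (some N) S y) :
    Flips ([.andC (c, true) (w - (r + 1), false) N] ++ A ++ [.cx c N] ++ B ++
        [.andDag (c, true) (w - (r + 1), true) N])
      w (r + 1) N (some c) (if y (w - (r + 1)) then S else T) y := by
  intro z hz hz0
  set d := w - (r + 1) with hd
  have hdz : z d = y d := hz d le_rfl (by omega)
  have hcd : c ≠ d := by omega
  have hcN : c ≠ N := by omega
  have hdN : d ≠ N := by omega
  have hfc := fun b x => hT.flipIf_apply b x (q := c) (by omega)
  have hfd := fun b x => hT.flipIf_apply b x (q := d) (by omega)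
  have hfN := fun b x => hT.flipIf_apply b x (q := N) (by omega)
  have hfu := fun b x => hT.flipIf_update b x (q := N) (by omega)
  have hgc := fun b x => hS.flipIf_apply b x (q := c) (by omega)
  have hgd := fun b x => hS.flipIf_apply b x (q := d) (by omega)
  have hgN := fun b x => hS.flipIf_apply b x (q := N) (by omega)
  have hgu := fun b x => hS.flipIf_update b x (q := N) (by omega)
  have hzN : z N = false := hz0 N le_rfl
  obtain ⟨h₁, h₂⟩ := hA (Function.update z N (z c && !(y d)))
    (fun q hq hq' => by rw [Function.update_of_ne (by omega)]; exact hz q (by omega) hq')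
    (fun q hq => by rw [Function.update_of_ne (by omega)]; exact hz0 q (by omega))
  obtain ⟨h₃, h₄⟩ := hB (Function.update (flipIf (z c && !(y d)) T z) N (z c && y d))
    (fun q hq hq' => by
      rw [Function.update_of_ne (by omega), hT.flipIf_apply _ _ (by omega)]
      exact hz q (by omega) hq')
    (fun q hq => by
      rw [Function.update_of_ne (by omega), hT.flipIf_apply _ _ (by omega)]
      exact hz0 q (by omega))
  have h₀ : (Gate.andC (c, true) (d, false) N).act z =
      Function.update z N (z c && !(y d)) := by
    simp [Gate.act, hzN, active, hdz]
  have h₅ : (Gate.cx c N).act (Function.update (flipIf (z c && !(y d)) T z) N (z c && !(y d))) =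
      Function.update (flipIf (z c && !(y d)) T z) N (z c && y d) := by
    simp only [Gate.act, Function.update_self, Function.update_of_ne hcN, hfc,
      Function.update_idem]
    cases z c <;> simp
  simp only [controlValue, Function.update_self] at h₂ h₄
  simp only [List.cons_append, List.nil_append, valid_cons, h₀, act_cons, valid_append, act_append,
    h₁, h₂, h₃, h₄, h₅, true_and, act_nil, valid_nil, and_true, hfu, hgu]
  simp only [Gate.Ok, Gate.WellFormed, Gate.wires, Gate.act, Function.update_self, active,
    Function.update_of_ne hcN, Function.update_of_ne hdN, hfc, hfd, hgc, hgd, hzN, hdz,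
    Function.update_idem, controlValue]
  refine ⟨by simp [hcd, hcN, hdN], ?_⟩
  rw [(Function.update_eq_self_iff).2 (by rw [hgN, hfN, hzN])]
  cases y d <;> simp

theorem flips_left {w n r N : ℕ} {A : Circuit} {T : Option ℕ} {y : Bits}
    (hr : r < w) (hwn : w ≤ n) (hN : n ≤ N)
    (hT : TargetOk w n T) (hA : Flips A w r N (some (w - (r + 1))) T y) :
    Flips ([.x (w - (r + 1))] ++ A ++ [.x (w - (r + 1))])
      w (r + 1) N none (if y (w - (r + 1)) then none else T) y := by
  intro z hz hz0
  set d := w - (r + 1) with hd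
  have hdz : z d = y d := hz d le_rfl (by omega)
  have hfd := fun b x => hT.flipIf_apply b x (q := d) (by omega)
  have hfu := fun b x => hT.flipIf_update b x (q := d) (by omega)
  obtain ⟨h₁, h₂⟩ := hA (Function.update z d (!(y d)))
    (fun q hq hq' => by rw [Function.update_of_ne (by omega)]; exact hz q (by omega) hq')
    (fun q hq => by rw [Function.update_of_ne (by omega)]; exact hz0 q (by omega))
  have h₀ : (Gate.x d).act z = Function.update z d (!(y d)) := by simp [Gate.act, hdz]
  simp only [controlValue, Function.update_self] at h₂
  simp only [List.cons_append, List.nil_append, valid_cons, h₀, act_cons, valid_append, act_append,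
    h₁, h₂, true_and, act_nil, valid_nil, and_true, hfu]
  simp only [Gate.Ok, Gate.WellFormed, Gate.wires, Gate.act, Function.update_self,
    Function.update_idem, controlValue, Bool.not_not]
  refine ⟨by simp, ?_⟩
  rw [(Function.update_eq_self_iff).2 (by rw [hfd, hdz])]
  cases y d <;> simp

theorem flips_right {w r N : ℕ} {A : Circuit} {T : Option ℕ} {y : Bits}
    (hr : r < w) (hA : Flips A w r N (some (w - (r + 1))) T y) :
    Flips A w (r + 1) N none (if y (w - (r + 1)) then T else none) y := by
  intro z hz hz0
  obtain ⟨h₁, h₂⟩ := hA z (fun q hq hq' => hz q (by omega) hq') hz0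
  refine ⟨h₁, ?_⟩
  rw [h₂, controlValue, controlValue, hz _ le_rfl (by omega)]
  cases y (w - (r + 1)) <;> simp

theorem flips_left_right {w n r N : ℕ} {A B : Circuit} {T S : Option ℕ} {y : Bits}
    (hr : r < w) (hwn : w ≤ n) (hN : n ≤ N)
    (hT : TargetOk w n T) (hA : Flips A w r N (some (w - (r + 1))) T y)
    (hB : Flips B w r N (some (w - (r + 1))) S y) :
    Flips ([.x (w - (r + 1))] ++ A ++ [.x (w - (r + 1))] ++ B)
      w (r + 1) N none (if y (w - (r + 1)) then S else T) y := by
  intro z hz hz0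
  obtain ⟨h₁, h₂⟩ := flips_left hr hwn hN hT hA z hz hz0
  have hT' : TargetOk w n (if y (w - (r + 1)) then none else T) := by
    split_ifs
    · simp [TargetOk]
    · exact hT
  obtain ⟨h₃, h₄⟩ := flips_right hr hB (act ([.x (w - (r + 1))] ++ A ++ [.x (w - (r + 1))]) z)
    (fun q hq hq' => by rw [h₂, hT'.flipIf_apply _ _ (by omega)]; exact hz q (by omega) hq')
    (fun q hq => by rw [h₂, hT'.flipIf_apply _ _ (by omega)]; exact hz0 q (by omega))
  refine ⟨(valid_append _ _ _).2 ⟨h₁, h₃⟩, ?_⟩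
  rw [act_append, h₄, h₂]
  cases y (w - (r + 1)) <;> simp [controlValue]

theorem Flips.of_ignored {w r N : ℕ} {A : Circuit} {control T : Option ℕ} {y : Bits}
    (hA : Flips A w r N control T y) : Flips A w (r + 1) N control T y :=
  fun z hz hz0 => hA z (fun q hq hq' => hz q (by omega) hq') hz0

theorem puiNode_some (restricted : Bool) (n w lo hi : ℕ) (U : ℕ → Option ℕ) (r i a c : ℕ) :
    puiNode restricted n w lo hi U (r + 1) i a (some c) =
      if lo < i + 2 ^ r ∧ i < hi then
        if lo < i + 2 ^ r + 2 ^ r ∧ i + 2 ^ r < hi then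
          [.andC (c, true) (w - (r + 1), false) (n + a)] ++
            puiNode restricted n w lo hi U r i (a + 1) (some (n + a)) ++ [.cx c (n + a)] ++
            puiNode restricted n w lo hi U r (i + 2 ^ r) (a + 1) (some (n + a)) ++
            [.andDag (c, true) (w - (r + 1), true) (n + a)]
        else if restricted then
          [.andC (c, true) (w - (r + 1), false) (n + a)] ++
            puiNode restricted n w lo hi U r i (a + 1) (some (n + a)) ++
            [.andDag (c, true) (w - (r + 1), false) (n + a)]
        else puiNode restricted n w lo hi U r i a (some c)
      else
        [.andC (c, true) (w - (r + 1), true) (n + a)] ++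
          puiNode restricted n w lo hi U r (i + 2 ^ r) (a + 1) (some (n + a)) ++
          [.andDag (c, true) (w - (r + 1), true) (n + a)] := rfl

theorem puiNode_none (restricted : Bool) (n w lo hi : ℕ) (U : ℕ → Option ℕ) (r i a : ℕ) :
    puiNode restricted n w lo hi U (r + 1) i a none =
      if lo < i + 2 ^ r ∧ i < hi then
        if lo < i + 2 ^ r + 2 ^ r ∧ i + 2 ^ r < hi then
          [.x (w - (r + 1))] ++ puiNode restricted n w lo hi U r i a (some (w - (r + 1))) ++
            [.x (w - (r + 1))] ++
            puiNode restricted n w lo hi U r (i + 2 ^ r) a (some (w - (r + 1)))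
        else if restricted then
          [.x (w - (r + 1))] ++ puiNode restricted n w lo hi U r i a (some (w - (r + 1))) ++
            [.x (w - (r + 1))]
        else puiNode restricted n w lo hi U r i a none
      else puiNode restricted n w lo hi U r (i + 2 ^ r) a (some (w - (r + 1))) := rfl

/-- `Flips` fixes only the address qubits still to be read, because the states met in the recursion
differ from `y` elsewhere: in conjugated address qubits, ancillas and flipped targets. A control is
an address qubit already read or an ancilla in use, hence never a target. -/
theorem puiNode_flips {restricted : Bool} {n w lo hi : ℕ} {U : ℕ → Option ℕ} (hwn : w ≤ n)
    (hU : ∀ i, TargetOk w n (U i)) (y : Bits) {r i a : ℕ} {control : Option ℕ} (hr : r ≤ w)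
    (hc : ∀ c, control = some c → c < w - r ∨ n ≤ c ∧ c < n + a) :
    Flips (puiNode restricted n w lo hi U r i a control) w r (n + a) control
      ((selected restricted w lo hi y r i).bind U) y := by
  have hT : ∀ r i, TargetOk w n ((selected restricted w lo hi y r i).bind U) := fun r i => by
    cases selected restricted w lo hi y r i with
    | none => simp [TargetOk]
    | some i => exact hU i
  induction r generalizing i a control with
  | zero => exact leaf_flips hU (fun c h => by have := hc c h; omega) y
  | succ r ih =>
    have hd : ∀ c, some (w - (r + 1)) = some c → c < w - r ∨ n ≤ c ∧ c < n + a := by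
      rintro _ ⟨⟩; omega
    have ha : ∀ c, some (n + a) = some c → c < w - r ∨ n ≤ c ∧ c < n + (a + 1) := by
      rintro _ ⟨⟩; omega
    have hs : ∀ c, control = some c → c < w - r ∨ n ≤ c ∧ c < n + a := fun c h => by
      have := hc c h; omega
    have hb : ∀ S T : Option ℕ, (if y (w - (r + 1)) then S else T).bind U =
        if y (w - (r + 1)) then S.bind U else T.bind U := fun S T =>
      apply_ite (fun T : Option ℕ => T.bind U) _ S T
    rw [selected]
    cases control with
    | some c =>
      rw [puiNode_some]
      by_cases h₁ : lo < i + 2 ^ r ∧ i < hi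
      · by_cases h₂ : lo < i + 2 ^ r + 2 ^ r ∧ i + 2 ^ r < hi
        · simp only [if_pos h₁, if_pos h₂, hb]
          exact flips_and_both hr hwn (by omega) (hc c rfl) (hT _ _) (ih (by omega) ha)
            (hT _ _) (ih (by omega) ha)
        · simp only [if_pos h₁, if_neg h₂]
          cases restricted
          · exact (ih (by omega) hs).of_ignored
          · simp only [if_true, hb]
            convert flips_and false hr hwn (by omega) (hc c rfl) (hT _ _) (ih (by omega) ha)
              using 1
            cases y (w - (r + 1)) <;> simp
      · simp only [if_neg h₁, hb]
        exact flips_and true hr hwn (by omega) (hc c rfl) (hT _ _) (ih (by omega) ha)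
    | none =>
      rw [puiNode_none]
      by_cases h₁ : lo < i + 2 ^ r ∧ i < hi
      · by_cases h₂ : lo < i + 2 ^ r + 2 ^ r ∧ i + 2 ^ r < hi
        · simp only [if_pos h₁, if_pos h₂, hb]
          exact flips_left_right hr hwn (by omega) (hT _ _) (ih (by omega) hd) (ih (by omega) hd)
        · simp only [if_pos h₁, if_neg h₂]
          cases restricted
          · exact (ih (by omega) hs).of_ignored
          · simp only [if_true, hb]
            exact flips_left hr hwn (by omega) (hT _ _) (ih (by omega) hd)
      · simp only [if_neg h₁, hb]
        exact flips_right hr (ih (by omega) hd)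

theorem pui_flips {restricted : Bool} {n w lo hi : ℕ} {U : ℕ → Option ℕ} (hwn : w ≤ n)
    (hU : ∀ i, TargetOk w n (U i)) {y : Bits} (hy : ∀ q, n ≤ q → y q = false) :
    Valid (pui restricted n w lo hi U) y ∧ act (pui restricted n w lo hi U) y =
      flipAt y ((selected restricted w lo hi y w 0).bind U) :=
  puiNode_flips hwn hU y le_rfl (by simp) y (fun _ _ _ => rfl) hy

/-! ### Qubits used by the partial unary iteration -/

theorem leaf_wires {w n i : ℕ} {U : ℕ → Option ℕ} (hU : ∀ i, TargetOk w n (U i))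
    {control : Option ℕ} (hc : ∀ c, control = some c → c < w ∨ n ≤ c ∧ c < n + (w - 1)) :
    ∀ g ∈ leaf U control i, g.WellFormed ∧ ∀ q ∈ g.wires, q < n + (w - 1) := by
  intro g hg
  cases ht : U i with
  | none => simp [leaf, ht] at hg
  | some t =>
    have := hU i t ht
    cases control with
    | none =>
      simp only [leaf, ht, List.mem_singleton] at hg
      subst hg
      simp [Gate.WellFormed, Gate.wires]; omega
    | some c =>
      have := hc c rfl
      simp only [leaf, ht, List.mem_singleton] at hg
      subst hg
      simp [Gate.WellFormed, Gate.wires]; omega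

/-- The first control is an address qubit and takes no ancilla, so at most `w - 1` levels allocate
one. This is the invariant `a + r + 1 ≤ w`. -/
theorem puiNode_wires {restricted : Bool} {n w lo hi : ℕ} {U : ℕ → Option ℕ} (hwn : w < n)
    (hU : ∀ i, TargetOk w n (U i)) {r i a : ℕ} {control : Option ℕ} (hr : r ≤ w)
    (hn : control = none → a = 0)
    (hc : ∀ c, control = some c → a + r + 1 ≤ w ∧ (c < w - r ∨ n ≤ c ∧ c < n + a)) :
    ∀ g ∈ puiNode restricted n w lo hi U r i a control,
      g.WellFormed ∧ ∀ q ∈ g.wires, q < n + (w - 1) := by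
  induction r generalizing i a control with
  | zero => exact leaf_wires hU fun c h => by have := hc c h; omega
  | succ r ih =>
    cases control with
    | none =>
      obtain rfl := hn rfl
      have hx : (Gate.x (w - (r + 1))).WellFormed ∧
          ∀ q ∈ (Gate.x (w - (r + 1))).wires, q < n + (w - 1) := by
        simp [Gate.WellFormed, Gate.wires]; omega
      have hd := fun i => ih (i := i) (a := 0) (control := some (w - (r + 1))) (by omega) (by simp)
        (by rintro _ ⟨⟩; omega)
      have hs := ih (i := i) (a := 0) (control := none) (by omega) (by simp) (by simp)
      rw [puiNode_none]
      intro g hg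
      split_ifs at hg
      · simp only [List.mem_append, List.mem_singleton] at hg
        rcases hg with ((rfl | hg) | rfl) | hg
        exacts [hx, hd _ g hg, hx, hd _ g hg]
      · simp only [List.mem_append, List.mem_singleton] at hg
        rcases hg with (rfl | hg) | rfl
        exacts [hx, hd _ g hg, hx]
      · exact hs g hg
      · exact hd _ g hg
    | some c =>
      have hc := hc c rfl
      have hand : [c, w - (r + 1), n + a].Nodup ∧
          ∀ q ∈ [c, w - (r + 1), n + a], q < n + (w - 1) := by
        simp; omega
      have hcx : [c, n + a].Nodup ∧ ∀ q ∈ [c, n + a], q < n + (w - 1) := by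
        simp; omega
      have ha := fun i => ih (i := i) (a := a + 1) (control := some (n + a)) (by omega) (by simp)
        (by rintro _ ⟨⟩; omega)
      have hs := ih (i := i) (a := a) (control := some c) (by omega) (by simp)
        (by rintro _ ⟨⟩; omega)
      rw [puiNode_some]
      intro g hg
      split_ifs at hg
      · simp only [List.mem_append, List.mem_singleton] at hg
        rcases hg with (((rfl | hg) | rfl) | hg) | rfl
        exacts [hand, ha _ g hg, hcx, ha _ g hg, hand]
      · simp only [List.mem_append, List.mem_singleton] at hg
        rcases hg with (rfl | hg) | rfl
        exacts [hand, ha _ g hg, hand]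
      · exact hs g hg
      · simp only [List.mem_append, List.mem_singleton] at hg
        rcases hg with (rfl | hg) | rfl
        exacts [hand, ha _ g hg, hand]

theorem pui_wires {restricted : Bool} {n w lo hi : ℕ} {U : ℕ → Option ℕ} (hwn : w < n)
    (hU : ∀ i, TargetOk w n (U i)) :
    ∀ g ∈ pui restricted n w lo hi U, g.WellFormed ∧ ∀ q ∈ g.wires, q < n + (w - 1) :=
  puiNode_wires hwn hU le_rfl (fun _ => rfl) (by simp)

/-! ### The cost of the partial unary iteration -/

@[simp] theorem cost_leaf (U : ℕ → Option ℕ) (control : Option ℕ) (i : ℕ) :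
    cost (leaf U control i) = 0 := by
  unfold leaf
  split <;> simp [cost_cons, Gate.dagger, Gate.toffolis]

@[simp] theorem cost_x (q : ℕ) (G : Circuit) : cost (.x q :: G) = cost G := by
  simp [cost_cons, Gate.dagger, Gate.toffolis]

@[simp] theorem cost_cx (c t : ℕ) (G : Circuit) : cost (.cx c t :: G) = cost G := by
  simp [cost_cons, Gate.dagger, Gate.toffolis]

@[simp] theorem cost_swap (a b : ℕ) (G : Circuit) : cost (.swap a b :: G) = cost G := by
  simp [cost_cons, Gate.dagger, Gate.toffolis]

@[simp] theorem cost_tof (c₁ c₂ : Ctrl) (t : ℕ) (G : Circuit) :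
    cost (.tof c₁ c₂ t :: G) = cost G + 1 := by
  simp [cost_cons, Gate.dagger, Gate.toffolis, add_comm]

@[simp] theorem cost_andC (c₁ c₂ : Ctrl) (t : ℕ) (G : Circuit) :
    cost (.andC c₁ c₂ t :: G) = cost G := by
  simp [cost_cons, Gate.dagger, Gate.toffolis]

@[simp] theorem cost_andDag (c₁ c₂ : Ctrl) (t : ℕ) (G : Circuit) :
    cost (.andDag c₁ c₂ t :: G) = cost G + 1 := by
  simp [cost_cons, Gate.dagger, Gate.toffolis, add_comm]

section PartialUnaryIterationCost

variable {restricted : Bool} {n w lo hi : ℕ} {U : ℕ → Option ℕ}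

/-- Each of the `2 ^ r - 1` inner nodes uses one AND/AND† pair. Without a control the root is free,
which saves one more in `cost_puiNode_full_none`. -/
theorem cost_puiNode_full_some {r i a c : ℕ} (hlo : lo ≤ i) (hhi : i + 2 ^ r ≤ hi) :
    cost (puiNode restricted n w lo hi U r i a (some c)) = 2 ^ r - 1 := by
  induction r generalizing i a c with
  | zero => simp [puiNode]
  | succ r ih =>
    have := Nat.two_pow_pos r
    rw [pow_succ] at hhi ⊢
    rw [puiNode_some, if_pos (by omega), if_pos (by omega)]
    simp only [cost_append, cost_andC, cost_cx, cost_andDag, cost_nil]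
    rw [ih (by omega) (by omega), ih (by omega) (by omega)]
    omega

theorem cost_puiNode_full_none {r i a : ℕ} (hlo : lo ≤ i) (hhi : i + 2 ^ r ≤ hi) :
    cost (puiNode restricted n w lo hi U r i a none) = 2 ^ r - 2 := by
  cases r with
  | zero => simp [puiNode]
  | succ r =>
    have := Nat.two_pow_pos r
    rw [pow_succ] at hhi ⊢
    rw [puiNode_none, if_pos (by omega), if_pos (by omega)]
    simp only [cost_append, cost_x, cost_nil]
    rw [cost_puiNode_full_some (by omega) (by omega),
      cost_puiNode_full_some (by omega) (by omega)]
    omega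

/-- The number of ones among the last `e` binary digits. -/
def ones : ℕ → ℕ → ℕ
  | 0, _ => 0
  | e + 1, j => if j < 2 ^ e then ones e j else ones e (j - 2 ^ e) + 1

theorem ones_pos {e j : ℕ} (hj : 0 < j) (h : j < 2 ^ e) : 0 < ones e j := by
  induction e with
  | zero => simp at h; omega
  | succ e ih =>
    rw [ones]
    split_ifs with h'
    · exact ih h'
    · omega

/-- On average at most half of the digits are 1 in an initial segment. In the induction, the D
numbers from `2 ^ e` on repeat the first D with one extra digit 1, and `2 * D ≤ 2 ^ e + D`. -/
theorem two_mul_sum_ones_le {e B : ℕ} (hB : B ≤ 2 ^ e) :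
    2 * ∑ j ∈ Finset.range B, ones e j ≤ B * e := by
  induction e generalizing B with
  | zero => simp [ones]
  | succ e ih =>
    rw [pow_succ] at hB
    by_cases h : B ≤ 2 ^ e
    · rw [Finset.sum_congr rfl fun j hj => show ones (e + 1) j = ones e j by
        rw [ones, if_pos ((Finset.mem_range.1 hj).trans_le h)]]
      exact (ih h).trans (Nat.mul_le_mul_left _ (by omega))
    · obtain ⟨D, rfl⟩ := Nat.exists_eq_add_of_le (not_le.1 h).le
      have h₁ := ih le_rfl
      have h₂ := ih (show D ≤ 2 ^ e by omega)
      have h₃ : ∑ j ∈ Finset.range (2 ^ e), ones (e + 1) j =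
          ∑ j ∈ Finset.range (2 ^ e), ones e j :=
        Finset.sum_congr rfl fun j hj => by rw [ones, if_pos (Finset.mem_range.1 hj)]
      have h₄ : ∑ j ∈ Finset.range D, ones (e + 1) (2 ^ e + j) =
          ∑ j ∈ Finset.range D, ones e j + D := by
        rw [Finset.sum_congr rfl fun j _ => show ones (e + 1) (2 ^ e + j) = ones e j + 1 by
          rw [ones, if_neg (by omega), Nat.add_sub_cancel_left], Finset.sum_add_distrib]
        simp
      rw [Finset.sum_range_add, h₃, h₄]
      have : (2 ^ e + D) * (e + 1) = 2 ^ e * e + D * e + 2 ^ e + D := by ring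
      omega

/-- On the way down to an aligned block, left turns are ignored and right turns cost one AND each;
the block itself is a full subtree. Without a control, the first right turn is free. -/
theorem cost_puiNode_block_some {p e i j a c : ℕ} (hj : j < 2 ^ e) (hlo : lo = i + j * 2 ^ p)
    (hhi : hi = lo + 2 ^ p) :
    cost (puiNode false n w lo hi U (e + p) i a (some c)) = ones e j + 2 ^ p - 1 := by
  induction e generalizing i j a c with
  | zero =>
    obtain rfl : j = 0 := by simpa using hj
    rw [zero_add, cost_puiNode_full_some (by omega) (by omega), ones, zero_add]
  | succ e ih =>
    have hp := Nat.two_pow_pos p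
    rw [show e + 1 + p = e + p + 1 by omega, puiNode_some, ones, pow_add 2 e p]
    by_cases h : j < 2 ^ e
    · have : (j + 1) * 2 ^ p ≤ 2 ^ e * 2 ^ p := Nat.mul_le_mul_right _ h
      rw [add_mul] at this
      rw [if_pos (by omega), if_neg (by omega), if_neg (by simp), if_pos h, ih h hlo]
    · obtain ⟨d, rfl⟩ := Nat.exists_eq_add_of_le (not_lt.1 h)
      rw [add_mul] at hlo
      rw [if_neg (by omega), if_neg h, Nat.add_sub_cancel_left]
      simp only [cost_append, cost_andC, cost_andDag, cost_nil]
      rw [ih (j := d) (by rw [pow_succ] at hj; omega) (by omega)]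
      omega

theorem cost_puiNode_block_none {p e i j a : ℕ} (hj : j < 2 ^ e) (hlo : lo = i + j * 2 ^ p)
    (hhi : hi = lo + 2 ^ p) :
    cost (puiNode false n w lo hi U (e + p) i a none) = ones e j + 2 ^ p - 2 := by
  induction e generalizing i j a with
  | zero =>
    obtain rfl : j = 0 := by simpa using hj
    rw [zero_add, cost_puiNode_full_none (by omega) (by omega), ones, zero_add]
  | succ e ih =>
    have hp := Nat.two_pow_pos p
    rw [show e + 1 + p = e + p + 1 by omega, puiNode_none, ones, pow_add 2 e p]
    by_cases h : j < 2 ^ e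
    · have : (j + 1) * 2 ^ p ≤ 2 ^ e * 2 ^ p := Nat.mul_le_mul_right _ h
      rw [add_mul] at this
      rw [if_pos (by omega), if_neg (by omega), if_neg (by simp), if_pos h, ih h hlo]
    · obtain ⟨d, rfl⟩ := Nat.exists_eq_add_of_le (not_lt.1 h)
      rw [add_mul] at hlo
      rw [if_neg (by omega), if_neg h, Nat.add_sub_cancel_left,
        cost_puiNode_block_some (j := d) (by rw [pow_succ] at hj; omega) (by omega) hhi]
      omega

/-- At each level either the left half is full, and with the node's own AND it costs exactly its
number of leaves, or only the left half is met and one AND is spent on the level. This gives the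
summands `hi - i` and `r`. -/
theorem cost_puiNode_prefix_some {r i a c : ℕ} (hlo : lo ≤ i) (hhi : i < hi)
    (hhi' : hi ≤ i + 2 ^ r) :
    cost (puiNode true n w lo hi U r i a (some c)) + 1 ≤ hi - i + r := by
  induction r generalizing i a c with
  | zero => simp [puiNode]; omega
  | succ r ih =>
    have hp := Nat.two_pow_pos r
    rw [pow_succ] at hhi'
    rw [puiNode_some, if_pos (by omega)]
    by_cases h : i + 2 ^ r < hi
    · rw [if_pos (by omega)]
      simp only [cost_append, cost_andC, cost_cx, cost_andDag, cost_nil]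
      rw [cost_puiNode_full_some (by omega) (by omega)]
      have := ih (i := i + 2 ^ r) (a := a + 1) (c := n + a) (by omega) h (by omega)
      omega
    · rw [if_neg (by omega), if_pos rfl]
      simp only [cost_append, cost_andC, cost_andDag, cost_nil]
      have := ih (i := i) (a := a + 1) (c := n + a) (by omega) hhi (by omega)
      omega

theorem cost_puiNode_prefix_none {r i a : ℕ} (hlo : lo ≤ i) (hhi : i < hi)
    (hhi' : hi ≤ i + 2 ^ r) :
    cost (puiNode true n w lo hi U r i a none) ≤ hi - i + r - 2 := by
  cases r with
  | zero => simp [puiNode]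
  | succ r =>
    have hp := Nat.two_pow_pos r
    rw [pow_succ] at hhi'
    rw [puiNode_none, if_pos (by omega)]
    by_cases h : i + 2 ^ r < hi
    · rw [if_pos (by omega)]
      simp only [cost_append, cost_x, cost_nil]
      rw [cost_puiNode_full_some (by omega) (by omega)]
      have := cost_puiNode_prefix_some (n := n) (w := w) (U := U) (i := i + 2 ^ r) (r := r) (a := a)
        (c := w - (r + 1)) (by omega : lo ≤ _) h (by omega)
      omega
    · rw [if_neg (by omega), if_pos rfl]
      simp only [cost_append, cost_x, cost_nil]
      have := cost_puiNode_prefix_some (n := n) (w := w) (U := U) (r := r) (a := a)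
        (c := w - (r + 1)) hlo hhi (by omega)
      omega

/-- The restricted version pays one AND for every turn above the block, left or right, so `e` is
added to the bound for a prefix. -/
theorem cost_puiNode_partial_some {p e i j a c : ℕ} (hj : j < 2 ^ e) (hlo : lo = i + j * 2 ^ p)
    (hhi : lo < hi) (hhi' : hi ≤ lo + 2 ^ p) :
    cost (puiNode true n w lo hi U (e + p) i a (some c)) + 1 ≤ hi - lo + (e + p) := by
  induction e generalizing i j a c with
  | zero =>
    obtain rfl : j = 0 := by simpa using hj
    obtain rfl : lo = i := by omega
    rw [zero_add]
    exact cost_puiNode_prefix_some le_rfl hhi hhi'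
  | succ e ih =>
    have hp := Nat.two_pow_pos p
    rw [show e + 1 + p = e + p + 1 by omega, puiNode_some, pow_add 2 e p]
    by_cases h : j < 2 ^ e
    · have : (j + 1) * 2 ^ p ≤ 2 ^ e * 2 ^ p := Nat.mul_le_mul_right _ h
      rw [add_mul] at this
      rw [if_pos (by omega), if_neg (by omega), if_pos rfl]
      simp only [cost_append, cost_andC, cost_andDag, cost_nil]
      have := ih (a := a + 1) (c := n + a) h hlo
      omega
    · obtain ⟨d, rfl⟩ := Nat.exists_eq_add_of_le (not_lt.1 h)
      rw [add_mul] at hlo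
      rw [if_neg (by omega)]
      simp only [cost_append, cost_andC, cost_andDag, cost_nil]
      have := ih (i := i + 2 ^ e * 2 ^ p) (j := d) (a := a + 1) (c := n + a)
        (by rw [pow_succ] at hj; omega) (by omega)
      omega

theorem cost_puiNode_partial_none {p e i j a : ℕ} (hj : j < 2 ^ e) (hlo : lo = i + j * 2 ^ p)
    (hhi : lo < hi) (hhi' : hi ≤ lo + 2 ^ p) :
    cost (puiNode true n w lo hi U (e + p) i a none) ≤ hi - lo + (e + p) - 2 := by
  cases e with
  | zero =>
    obtain rfl : j = 0 := by simpa using hj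
    obtain rfl : lo = i := by omega
    rw [zero_add]
    exact cost_puiNode_prefix_none le_rfl hhi hhi'
  | succ e =>
    have hp := Nat.two_pow_pos p
    rw [show e + 1 + p = e + p + 1 by omega, puiNode_none, pow_add 2 e p]
    by_cases h : j < 2 ^ e
    · have : (j + 1) * 2 ^ p ≤ 2 ^ e * 2 ^ p := Nat.mul_le_mul_right _ h
      rw [add_mul] at this
      rw [if_pos (by omega), if_neg (by omega), if_pos rfl]
      simp only [cost_append, cost_x, cost_nil]
      have := cost_puiNode_partial_some (n := n) (w := w) (U := U) (a := a) (c := w - (e + p + 1))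
        h hlo hhi hhi'
      omega
    · obtain ⟨d, rfl⟩ := Nat.exists_eq_add_of_le (not_lt.1 h)
      rw [add_mul] at hlo
      rw [if_neg (by omega)]
      have := cost_puiNode_partial_some (n := n) (w := w) (U := U) (i := i + 2 ^ e * 2 ^ p)
        (j := d) (e := e) (a := a) (c := w - (e + p + 1))
        (by rw [pow_succ] at hj; omega) (by omega) hhi hhi'
      omega

/-- The cost of the unrestricted partial unary iteration over the `j`-th block of `2 ^ p`
addresses. -/
theorem cost_pui_block {p e j : ℕ} (hj : j < 2 ^ e) :
    cost (pui false n (e + p) (j * 2 ^ p) (j * 2 ^ p + 2 ^ p) U) = ones e j + 2 ^ p - 2 :=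
  cost_puiNode_block_none hj (by omega) rfl

/-- The cost of the restricted partial unary iteration over the beginning of the `j`-th block of
`2 ^ p` addresses. -/
theorem cost_pui_partial {p e j k : ℕ} (hj : j < 2 ^ e) (hk : j * 2 ^ p < k)
    (hk' : k ≤ j * 2 ^ p + 2 ^ p) :
    cost (pui true n (e + p) (j * 2 ^ p) k U) ≤ k - j * 2 ^ p + (e + p) - 2 :=
  cost_puiNode_partial_none hj (by omega) hk hk'

end PartialUnaryIterationCost

/-! ### Circuits that leave qubits or basis states alone -/

theorem Gate.act_of_notMem {g : Gate} {y : Bits} {q : ℕ} (h : q ∉ g.wires) : g.act y q = y q := by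
  cases g <;> simp only [Gate.wires, List.mem_cons, List.not_mem_nil, or_false, not_or] at h <;>
    simp only [Gate.act]
  case swap a b => rw [Equiv.swap_apply_of_ne_of_ne h.1 h.2]
  all_goals exact Function.update_of_ne (by tauto) _ _

theorem act_of_notMem {G : Circuit} {y : Bits} {q : ℕ} (h : ∀ g ∈ G, q ∉ g.wires) :
    act G y q = y q := by
  induction G generalizing y with
  | nil => rfl
  | cons g G ih =>
    rw [act_cons, ih fun g hg => h g (List.mem_cons_of_mem _ hg),
      Gate.act_of_notMem (h g List.mem_cons_self)]

theorem act_map_cx {L : List ℕ} {c : ℕ} (hL : L.Nodup) (hc : c ∉ L) (z : Bits) :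
    act (L.map fun q => .cx c q) z = fun q => xor (z q) (z c && decide (q ∈ L)) := by
  induction L generalizing z with
  | nil => simp
  | cons t L ih =>
    rw [List.nodup_cons] at hL
    rw [List.mem_cons, not_or] at hc
    rw [List.map_cons, act_cons, ih hL.2 hc.2]
    funext q
    simp only [Gate.act, Function.update_of_ne hc.1]
    by_cases hq : q = t
    · subst hq; simp [hL.1]
    · simp [hq]

theorem valid_map_cx {L : List ℕ} {c : ℕ} (hc : c ∉ L) (z : Bits) :
    Valid (L.map fun q => .cx c q) z := by
  induction L generalizing z with
  | nil => trivial
  | cons t L ih =>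
    rw [List.mem_cons, not_or] at hc
    exact ⟨⟨by simpa [Gate.WellFormed, Gate.wires] using hc.1, trivial⟩, ih hc.2 _⟩

theorem cost_map_cx (L : List ℕ) (c : ℕ) : cost (L.map fun q => .cx c q) = 0 := by
  induction L with
  | nil => rfl
  | cons t L ih => rw [List.map_cons, cost_cx, ih]

theorem control_notMem_cmx (n c : ℕ) (x y : Bits) :
    c ∉ (List.range n).filter fun q => q ≠ c ∧ x q ≠ y q := by simp

theorem valid_cmx (n c : ℕ) (x y z : Bits) : Valid (cmx n c x y) z :=
  valid_map_cx (control_notMem_cmx n c x y) z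

theorem cost_cmx (n c : ℕ) (x y : Bits) : cost (cmx n c x y) = 0 := cost_map_cx _ _

theorem cmx_wires {n c : ℕ} (hc : c < n) (x y : Bits) :
    ∀ g ∈ cmx n c x y, g.WellFormed ∧ ∀ q ∈ g.wires, q < n := by
  intro g hg
  simp only [cmx, List.mem_map, List.mem_filter, List.mem_range, decide_eq_true_eq] at hg
  obtain ⟨q, ⟨hq, hqc, -⟩, rfl⟩ := hg
  simp [Gate.WellFormed, Gate.wires, hc, hq, Ne.symm hqc]

theorem act_cmx_of_false {n c : ℕ} {x y z : Bits} (hz : z c = false) : act (cmx n c x y) z = z := by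
  rw [cmx, act_map_cx (List.nodup_range.filter _) (control_notMem_cmx n c x y)]
  simp [hz]

theorem act_cmx {n c : ℕ} {x y : Bits} (hx : x c = true) (hy : y c = true)
    (hxy : ∀ q, n ≤ q → x q = y q) : act (cmx n c x y) x = y := by
  rw [cmx, act_map_cx (List.nodup_range.filter _) (control_notMem_cmx n c x y)]
  funext q
  simp only [hx, Bool.true_and, List.mem_filter, List.mem_range, decide_eq_true_eq]
  by_cases hq : q < n
  · by_cases hqc : q = c
    · subst hqc; simp [hx, hy]
    · cases h₁ : x q <;> cases h₂ : y q <;> simp [hq, hqc]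
  · simp [hq, hxy q (by omega)]

theorem flipAt_batchKet (l k b : ℕ) : flipAt (batchKet l k b) (some (l + b)) = subKet l k := by
  have : subKet l k (l + b) = false := inSubspace_subKet l k _ (by omega)
  simp only [flipAt, batchKet, Function.update_self, Function.update_idem, Bool.not_true]
  rw [← this, Function.update_eq_self]

theorem extend_injective (n : ℕ) : Function.Injective (extend (n := n)) := fun x y h => by
  funext q
  simpa [extend] using congrFun h q

theorem le_two_pow_subBits (s : ℕ) : s ≤ 2 ^ subBits s := Nat.le_pow_clog (by norm_num) s

/-! ### The invariant of the main loop -/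

namespace AlgState

variable {n s : ℕ} {C : Fin s → Fin n → Bool} {c : AlgState s}

/-- The budget of the `i`-th block of addresses, for blocks of size `m`. -/
def blockCost (m e i : ℕ) : ℕ := (m - 1) + (ones e i + m - 2)

/-- The logarithm of the number of blocks. -/
def blockBits (n s : ℕ) : ℕ := subBits s - Nat.log 2 (n - subBits s)

/-- The circuit found so far produces the tableau. -/
structure Sound (n : ℕ) (C : Fin s → Fin n → Bool) (c : AlgState s) : Prop where
  tab_eq : ∀ i, c.tab i = act c.circ (extend (C i))
  valid : ∀ i, Valid c.circ (extend (C i))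
  wires : ∀ g ∈ c.circ, g.WellFormed ∧ ∀ q ∈ g.wires, q < n + (subBits s - 1)
  zero : ∀ i q, n ≤ q → c.tab i q = false

theorem Sound.append (h : Sound n C c) {P : Circuit} (hv : ∀ i, Valid P (c.tab i))
    (hw : ∀ g ∈ P, g.WellFormed ∧ ∀ q ∈ g.wires, q < n + (subBits s - 1))
    (hz : ∀ i q, n ≤ q → act P (c.tab i) q = false) : Sound n C (c.append P) where
  tab_eq i := by simp [AlgState.append, h.tab_eq]
  valid i := (valid_append _ _ _).2 ⟨h.valid i, h.tab_eq i ▸ hv i⟩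
  wires g hg := (List.mem_append.1 hg).elim (h.wires g) (hw g)
  zero := hz

theorem Sound.tab_injective (h : Sound n C c) (hC : Function.Injective C) :
    Function.Injective c.tab := fun i j hij => by
  rw [h.tab_eq, h.tab_eq] at hij
  exact hC (extend_injective n ((h.valid i).act_injective (h.valid j) hij))

/-- The invariant of the main loop. -/
structure Invariant (n : ℕ) (C : Fin s → Fin n → Bool) (c : AlgState s) : Prop
    extends Sound n C c where
  row : ∀ q e, c.batch[q]? = some e →
    c.tab e.1 = batchKet (subBits s) e.2 q ∧ c.start ≤ e.2 ∧ e.2 < c.k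
  nodup : (c.batch.map Prod.snd).Nodup
  free : ∀ e ∈ c.batch, ∀ j, c.tab j ≠ subKet (subBits s) e.2
  cover : ∀ i < c.k, ∃ j, ¬ c.Pending j ∧ address (subBits s) (c.tab j) = i
  k_le : c.k ≤ s
  start_le : c.start ≤ c.k
  k_le_start : c.k ≤ c.start + batchSize n s
  length_le : c.batch.length ≤ c.k - c.start
  cost_le : ∃ j, c.start = j * batchSize n s ∧ cost c.circ ≤
    ∑ i ∈ Finset.range j, blockCost (batchSize n s) (blockBits n s) i + (c.batch.length - 1)

theorem invariant_initial (C : Fin s → Fin n → Bool) : Invariant n C (initial C) where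
  tab_eq _ := rfl
  valid _ := trivial
  wires := by simp [initial]
  zero i q hq := by simp [initial, extend]; omega
  row := by simp [initial]
  nodup := by simp [initial]
  free := by simp [initial]
  cover := by simp [initial]
  k_le := Nat.zero_le _
  start_le := le_rfl
  k_le_start := Nat.zero_le _
  length_le := Nat.zero_le _
  cost_le := ⟨0, by simp [initial], by simp [initial]⟩

/-- The addresses below `k` are held by distinct rows that are not pending. A pending row is one
more row, so there are more than `k` rows. -/
theorem Invariant.k_lt (h : Invariant n C c) (hp : ∃ j, c.Pending j) : c.k < s := by
  choose f hf using fun i : Fin c.k => h.cover i i.2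
  have hinj : Function.Injective f := fun i i' hii => by
    rw [Fin.ext_iff, ← (hf i).2, ← (hf i').2, hii]
  obtain ⟨j, hj⟩ := hp
  have hsurj : ¬ Function.Surjective f := fun hs => by
    obtain ⟨i, rfl⟩ := hs j
    exact (hf i).1 hj
  simpa using Fintype.card_lt_of_injective_not_surjective f hinj hsurj

theorem Invariant.skip (h : Invariant n C c) (hb : c.Building n) (hk : c.Occupied) :
    Invariant n C { c with k := c.k + 1 } := by
  have hlt := h.k_lt hb.2
  exact
  { h with
    row := fun q e he => by
      have := h.row q e he
      exact ⟨this.1, this.2.1, by dsimp only; omega⟩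
    cover := fun i hi => by
      rcases Nat.lt_succ_iff_lt_or_eq.1 hi with hi | rfl
      · exact h.cover i hi
      · obtain ⟨j, hj⟩ := hk
        refine ⟨j, fun hp => hp.2 ?_, ?_⟩ <;> dsimp only <;> rw [hj]
        · exact inSubspace_subKet _ _
        · exact address_subKet (hlt.trans_le (le_two_pow_subBits s))
    k_le := hlt
    start_le := by have := h.start_le; dsimp only; omega
    k_le_start := by have := h.k_le_start; have := hb.1; dsimp only; omega
    length_le := by have := h.length_le; dsimp only; omega }

theorem Invariant.length_lt (h : Invariant n C c) (hn : subBits s < n)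
    (hb : c.k ≠ c.start + batchSize n s) : subBits s + c.batch.length < n := by
  have := h.length_le
  have := h.k_le_start
  have := h.start_le
  have := (batchSize_isGreatest n s hn).1.2
  omega

/-- It suffices that `pre` fixes the subspace states and the batch rows: these are 0 at the control
of the CX gates, so the whole appended circuit fixes them. All other rows may change arbitrarily. -/
theorem Invariant.add (h : Invariant n C c) (hn : subBits s < n) (hb : c.Building n)
    (hk : ¬ c.Occupied) {j : Fin s} {pre : Circuit}
    (hw : ∀ g ∈ pre, g.WellFormed ∧ ∀ q ∈ g.wires, q < n) (hv : ∀ y, Valid pre y)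
    (hsub : ∀ y, InSubspace (subBits s) y → act pre y = y)
    (hrow : ∀ (q : ℕ) (e : Fin s × ℕ), c.batch[q]? = some e → act pre (c.tab e.1) = c.tab e.1)
    (hpre : act pre (c.tab j) (subBits s + c.batch.length) = true)
    (hcost : cost pre ≤ 1 ∧ cost pre ≤ c.batch.length) :
    Invariant n C (c.add n pre j) := by
  have hlt := h.k_lt hb.2
  have hlt' := hlt.trans_le (le_two_pow_subBits s)
  have hlen := h.length_lt hn hb.1
  set l := subBits s with hl
  set b := c.batch.length with hbd
  set P := pre ++ cmx n (l + b) (act pre (c.tab j)) (batchKet l c.k b) with hP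
  have hwP : ∀ g ∈ P, g.WellFormed ∧ ∀ q ∈ g.wires, q < n := fun g hg =>
    (List.mem_append.1 hg).elim (hw g) (cmx_wires hlen _ _ g)
  have hvP : ∀ y, Valid P y := fun y => (valid_append _ _ _).2 ⟨hv y, valid_cmx _ _ _ _ _⟩
  have hzP : ∀ i q, n ≤ q → act P (c.tab i) q = false := fun i q hq => by
    rw [act_of_notMem fun g hg hm => absurd ((hwP g hg).2 q hm) (by omega)]
    exact h.zero i q hq
  have hzpre : ∀ i q, n ≤ q → act pre (c.tab i) q = false := fun i q hq => by
    rw [act_of_notMem fun g hg hm => absurd ((hw g hg).2 q hm) (by omega)]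
    exact h.zero i q hq
  have hjP : act P (c.tab j) = batchKet l c.k b := by
    rw [hP, act_append]
    refine act_cmx hpre (by simp [batchKet]) fun q hq => ?_
    rw [hzpre j q hq, batchKet_rest (by omega)]
    simp; omega
  have hsubP : ∀ y, InSubspace l y → act P y = y := fun y hy => by
    rw [hP, act_append, hsub y hy, act_cmx_of_false (hy _ (by omega))]
  have hrowP : ∀ (q : ℕ) (e : Fin s × ℕ), c.batch[q]? = some e →
      act P (c.tab e.1) = c.tab e.1 := fun q e he => by
    have hq := (List.getElem?_eq_some_iff.1 he).1
    rw [hP, act_append, hrow q e he, act_cmx_of_false]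
    rw [(h.row q e he).1, batchKet_rest (by omega)]
    simp; omega
  have hS : Sound n C (c.append P) := h.toSound.append (fun i => hvP _)
    (fun g hg => ⟨(hwP g hg).1, fun q hq => ((hwP g hg).2 q hq).trans_le (by omega)⟩) hzP
  exact
  { tab_eq := hS.tab_eq
    valid := hS.valid
    wires := hS.wires
    zero := hS.zero
    row := fun q e he => by
      change (c.batch ++ [(j, c.k)])[q]? = some e at he
      change act P (c.tab e.1) = _ ∧ c.start ≤ e.2 ∧ e.2 < c.k + 1
      rw [List.getElem?_append] at he
      split_ifs at he with hq
      · have := h.row q e he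
        exact ⟨(hrowP q e he).trans this.1, this.2.1, by omega⟩
      · obtain ⟨hq', rfl⟩ := List.getElem?_eq_some_iff.1 he
        have hq' : q - c.batch.length < 1 := hq'
        obtain rfl : q = b := by omega
        simpa [hjP, ← hl] using h.start_le
    nodup := by
      change ((c.batch ++ [(j, c.k)]).map Prod.snd).Nodup
      rw [List.map_append, List.nodup_append]
      refine ⟨h.nodup, by simp, ?_⟩
      rintro _ ha _ hb rfl
      obtain ⟨e, he, rfl⟩ := List.mem_map.1 ha
      obtain ⟨q, hq⟩ := List.mem_iff_getElem?.1 he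
      have := (h.row q e hq).2.2
      simp at hb; omega
    free := fun e he i hi => by
      change act P (c.tab i) = _ at hi
      -- The appended circuit is injective and fixes subspace states, so no row can newly arrive at
      -- |i⟩|0⟩.
      have hi' : c.tab i = subKet l e.2 := (hvP _).act_injective (hvP _)
        (hi.trans (hsubP _ (inSubspace_subKet _ _)).symm)
      rcases List.mem_append.1 he with he | he
      · exact h.free e he i hi'
      · obtain rfl := List.mem_singleton.1 he
        exact hk ⟨i, hi'⟩
    cover := fun i hi => by
      rcases Nat.lt_succ_iff_lt_or_eq.1 hi with hi | rfl
      · obtain ⟨i', hp, ha⟩ := h.cover i hi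
        have hfix : act P (c.tab i') = c.tab i' := by
          by_cases hs : InSubspace l (c.tab i')
          · exact hsubP _ hs
          · obtain ⟨a, hmem⟩ := not_not.1 fun hnb => hp ⟨hnb, hs⟩
            obtain ⟨q, hq⟩ := List.mem_iff_getElem?.1 hmem
            exact hrowP q _ hq
        refine ⟨i', fun hp' => hp ⟨fun ⟨a, hm⟩ => hp'.1 ⟨a, List.mem_append_left _ hm⟩, ?_⟩, ?_⟩
        · have := hp'.2
          change ¬ InSubspace l (act P (c.tab i')) at this
          rwa [hfix] at this
        · change address l (act P (c.tab i')) = i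
          rw [hfix, ha]
      · refine ⟨j, fun hp => hp.1 ⟨c.k, List.mem_append_right _ (by simp)⟩, ?_⟩
        change address l (act P (c.tab j)) = c.k
        rw [hjP, address_batchKet hlt']
    k_le := hlt
    start_le := h.start_le.trans (Nat.le_succ _)
    k_le_start := by
      have := h.k_le_start
      have := hb.1
      change c.k + 1 ≤ c.start + _
      omega
    length_le := by
      have := h.length_le
      have := h.start_le
      change (c.batch ++ [(j, c.k)]).length ≤ c.k + 1 - c.start
      rw [List.length_append, List.length_singleton]
      omega
    cost_le := by
      obtain ⟨i, hi, hc⟩ := h.cost_le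
      refine ⟨i, hi, ?_⟩
      -- Both bounds in `hcost` matter: the truncated `length - 1` does not grow with the first row
      -- of a batch, which must be free, and grows by one with each later row.
      change cost (c.circ ++ (pre ++ cmx n _ _ _)) ≤ _ + ((c.batch ++ [(j, c.k)]).length - 1)
      rw [cost_append, cost_append, cost_cmx, List.length_append, List.length_singleton]
      omega }

theorem Invariant.addSwap (h : Invariant n C c) (hn : subBits s < n) (hb : c.Building n)
    (hk : ¬ c.Occupied) {j : Fin s} {r : ℕ}
    (hr : subBits s + c.batch.length ≤ r) (hrn : r < n) (hjr : c.tab j r = true) :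
    Invariant n C (c.add n (if r = subBits s + c.batch.length then []
      else [.swap r (subBits s + c.batch.length)]) j) := by
  split_ifs with hrb
  · exact h.add hn hb hk (by simp) (fun _ => trivial) (fun _ _ => rfl) (fun _ _ _ => rfl)
      (hrb ▸ hjr) (by simp)
  · have hfix : ∀ y : Bits, y r = false → y (subBits s + c.batch.length) = false →
        act [.swap r (subBits s + c.batch.length)] y = y := fun y h₁ h₂ => by
      funext q
      simp only [act_cons, act_nil, Gate.act, Equiv.swap_apply_def]
      split_ifs with hq hq'
      · rw [hq, h₁, h₂]
      · rw [hq', h₁, h₂]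
      · rfl
    refine h.add hn hb hk ?_ (fun y => ?_) (fun y hy => ?_) (fun q e he => ?_) ?_ (by simp)
    · simp [Gate.WellFormed, Gate.wires, hrb, hrn, h.length_lt hn hb.1]
    · simp [Gate.Ok, Gate.WellFormed, Gate.wires, hrb]
    · exact hfix y (hy _ (by omega)) (hy _ (by omega))
    · have hq := (List.getElem?_eq_some_iff.1 he).1
      refine hfix _ ?_ ?_ <;> rw [(h.row q e he).1, batchKet_rest (by omega)] <;> simp <;> omega
    · simpa [Gate.act] using hjr

/-- The control `u` is 0 on the subspace and on all batch rows but one; on that one the control `v`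
is inactive. Row `j` and that batch row are both 0 at the target, so `v` is not the target. -/
theorem Invariant.addToffoli (h : Invariant n C c) (hn : subBits s < n) (hb : c.Building n)
    (hk : ¬ c.Occupied)
    (hno : ∀ i, ¬ c.InBatch i → ∀ r, subBits s + c.batch.length ≤ r → r < n → c.tab i r = false)
    {j : Fin s} (hj : c.Pending j) {u : ℕ} (hu : subBits s ≤ u) (hju : c.tab j u = true)
    {e : Fin s × ℕ} (he : c.batch[u - subBits s]? = some e)
    {v : ℕ} (hv : v < n) (hjv : c.tab j v ≠ c.tab e.1 v) :
    Invariant n C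
      (c.add n [.tof (u, true) (v, c.tab j v) (subBits s + c.batch.length)] j) := by
  have hlen := h.length_lt hn hb.1
  have hu' := (List.getElem?_eq_some_iff.1 he).1
  have hrow := h.row _ e he
  have heu : c.tab e.1 u = true := by
    rw [hrow.1, batchKet_rest hu]; simp; omega
  have hjt := hno j hj.1 _ le_rfl hlen
  have het : c.tab e.1 (subBits s + c.batch.length) = false := by
    rw [hrow.1, batchKet_rest (by omega)]; simp; omega
  have huv : u ≠ v := by rintro rfl; exact hjv (hju.trans heu.symm)
  have hvt : v ≠ subBits s + c.batch.length := by rintro rfl; exact hjv (hjt.trans het.symm)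
  have hut : u ≠ subBits s + c.batch.length := by omega
  refine h.add hn hb hk ?_ (fun y => ?_) (fun y hy => ?_) (fun q e' he' => ?_) ?_ ?_
  · simp [Gate.WellFormed, Gate.wires, huv, hvt, hut, hv, hlen]; omega
  · simp [Gate.Ok, Gate.WellFormed, Gate.wires, huv, hvt, hut]
  · simp [Gate.act, active, hy u hu]
  · simp only [act_cons, act_nil, Gate.act, Function.update_eq_self_iff]
    have hq := (List.getElem?_eq_some_iff.1 he').1
    by_cases hqu : q = u - subBits s
    · subst hqu
      rw [he] at he'
      obtain rfl := Option.some.inj he'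
      have : active (c.tab e.1) (v, c.tab j v) = false := by
        simpa [active] using Ne.symm hjv
      simp [this]
    · have : c.tab e'.1 u = false := by
        rw [(h.row q e' he').1, batchKet_rest hu]; simp; omega
      simp [active, this]
  · simp [Gate.act, active, hju, hjt]
  · simp; omega

/-! ### Zeroing the batch -/

theorem Invariant.zeroing_targetOk (h : Invariant n C c) (hn : subBits s < n) (i : ℕ) :
    TargetOk (subBits s) n (c.zeroing i) := by
  intro t ht
  simp only [zeroing, Option.map_eq_some_iff] at ht
  obtain ⟨q, hq, rfl⟩ := ht
  have := (List.findIdx?_eq_some_iff_getElem.1 hq).1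
  have := h.length_le
  have := h.k_le_start
  have := (batchSize_isGreatest n s hn).1.2
  omega

theorem Invariant.zeroing_eq_some (h : Invariant n C c) {q : ℕ} {e : Fin s × ℕ}
    (he : c.batch[q]? = some e) : c.zeroing e.2 = some (subBits s + q) := by
  rw [zeroing, Option.map_eq_some_iff]
  refine ⟨q, ?_, rfl⟩
  obtain ⟨hq, rfl⟩ := List.getElem?_eq_some_iff.1 he
  rw [List.findIdx?_eq_some_iff_getElem]
  refine ⟨hq, by simp, fun q' hq' => ?_⟩
  have := (h.nodup.getElem_inj_iff (i := q') (hi := by simpa using hq'.trans hq) (j := q)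
    (hj := by simpa using hq)).not.2 hq'.ne
  simpa using this

theorem zeroing_eq_none {i : ℕ} (h : ∀ e ∈ c.batch, e.2 ≠ i) : c.zeroing i = none := by
  simpa [zeroing, List.findIdx?_eq_none_iff] using fun a b hab => h (a, b) hab

theorem Invariant.zeroBatch_valid (h : Invariant n C c) (hn : subBits s < n) (restricted : Bool)
    (j : Fin s) : Valid (c.zeroBatch restricted n) (c.tab j) := by
  rw [zeroBatch]
  split_ifs
  · trivial
  · exact (pui_flips hn.le (h.zeroing_targetOk hn) (h.zero j)).1

theorem Invariant.zeroBatch_wires (h : Invariant n C c) (hn : subBits s < n)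
    (restricted : Bool) : ∀ g ∈ c.zeroBatch restricted n,
      g.WellFormed ∧ ∀ q ∈ g.wires, q < n + (subBits s - 1) := by
  rw [zeroBatch]
  split_ifs
  · simp
  · exact pui_wires hn (h.zeroing_targetOk hn)

theorem Invariant.act_zeroBatch (h : Invariant n C c) (hn : subBits s < n) (restricted : Bool)
    (j : Fin s) : ∃ T, TargetOk (subBits s) n T ∧
      act (c.zeroBatch restricted n) (c.tab j) = flipAt (c.tab j) T := by
  rw [zeroBatch]
  split_ifs
  · exact ⟨none, by simp [TargetOk], rfl⟩
  · refine ⟨_, ?_, (pui_flips hn.le (h.zeroing_targetOk hn) (h.zero j)).2⟩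
    cases selected restricted (subBits s) c.start c.k (c.tab j) (subBits s) 0 with
    | none => simp [TargetOk]
    | some i => exact h.zeroing_targetOk hn i

theorem Invariant.act_zeroBatch_batch (h : Invariant n C c) (hn : subBits s < n)
    (restricted : Bool) {e : Fin s × ℕ} (he : e ∈ c.batch) :
    act (c.zeroBatch restricted n) (c.tab e.1) = subKet (subBits s) e.2 := by
  obtain ⟨q, hq⟩ := List.mem_iff_getElem?.1 he
  obtain ⟨hrow, hlo, hhi⟩ := h.row q e hq
  have hlt : e.2 < 2 ^ subBits s := (hhi.trans_le h.k_le).trans_le (le_two_pow_subBits s)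
  have ha : lowAddress (subBits s) (subBits s) (c.tab e.1) = e.2 := by
    rw [← address_eq_lowAddress, hrow, address_batchKet hlt]
  rw [zeroBatch, if_neg (List.ne_nil_of_mem he),
    (pui_flips hn.le (h.zeroing_targetOk hn) (h.zero e.1)).2,
    selected_eq_some (by omega) (by omega), Option.bind_some, zero_add, ha,
    h.zeroing_eq_some hq, hrow, flipAt_batchKet]

/-- Inside the interval the row's leaf is the identity, since `free` excludes batch addresses; below
it nothing is selected. Above it only the restricted version is safe. -/
theorem Invariant.act_zeroBatch_subspace (h : Invariant n C c) (hn : subBits s < n)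
    {restricted : Bool} {j : Fin s} (hj : InSubspace (subBits s) (c.tab j))
    (hr : restricted = true ∨ address (subBits s) (c.tab j) < c.k) :
    act (c.zeroBatch restricted n) (c.tab j) = c.tab j := by
  rw [zeroBatch]
  split_ifs with hb
  · rfl
  · obtain ⟨e, he⟩ := List.exists_mem_of_ne_nil _ hb
    obtain ⟨q, hq⟩ := List.mem_iff_getElem?.1 he
    have hrow := h.row q e hq
    have hk := h.k_le.trans (le_two_pow_subBits s)
    rw [(pui_flips hn.le (h.zeroing_targetOk hn) (h.zero j)).2]
    rw [address_eq_lowAddress] at hr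
    by_cases hlo : lowAddress (subBits s) (subBits s) (c.tab j) < c.start
    · cases restricted
      · rw [selected_unrestricted_eq_none (by omega) (by omega) (by omega) (by omega)]; rfl
      · rw [selected_restricted_eq_none (by omega) (by omega) (by omega) (by omega)]; rfl
    · by_cases hhi : lowAddress (subBits s) (subBits s) (c.tab j) < c.k
      · rw [selected_eq_some (by omega) (by omega), Option.bind_some, zeroing_eq_none]
        · rfl
        · intro e' he' heq
          refine h.free e' he' j ?_
          rw [hj.eq_subKet, heq, zero_add, address_eq_lowAddress]
      · obtain rfl : restricted = true := hr.resolve_right hhi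
        rw [selected_restricted_eq_none (by omega) (by omega) (by omega) (by omega)]; rfl

theorem Invariant.append_zeroBatch (h : Invariant n C c) (hn : subBits s < n)
    (restricted : Bool) : Sound n C (c.append (c.zeroBatch restricted n)) := by
  refine h.toSound.append (h.zeroBatch_valid hn restricted) (h.zeroBatch_wires hn restricted)
    fun i q hq => ?_
  obtain ⟨T, hT, hact⟩ := h.act_zeroBatch hn restricted i
  rw [hact, ← h.zero i q hq]
  exact hT.flipIf_apply true _ (Or.inr hq)

theorem Invariant.close (h : Invariant n C c) (hn : subBits s < n)
    (hk : c.k = c.start + batchSize n s) :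
    Invariant n C { c.append (c.zeroBatch false n) with start := c.k, batch := [] } := by
  have hS := h.append_zeroBatch hn false
  have hks := h.k_le.trans (le_two_pow_subBits s)
  exact
  { tab_eq := hS.tab_eq
    valid := hS.valid
    wires := hS.wires
    zero := hS.zero
    row := by simp
    nodup := by simp
    free := by simp
    cover := fun i hi => by
      obtain ⟨j, hj, ha⟩ := h.cover i hi
      refine ⟨j, ?_⟩
      suffices hz : act (c.zeroBatch false n) (c.tab j) = subKet (subBits s) i by
        refine ⟨fun hp => hp.2 ?_, ?_⟩
        · change InSubspace _ (act (c.zeroBatch false n) (c.tab j))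
          rw [hz]
          exact inSubspace_subKet _ _
        · change address _ (act (c.zeroBatch false n) (c.tab j)) = i
          rw [hz]
          exact address_subKet (lt_of_lt_of_le hi hks)
      by_cases hs : InSubspace (subBits s) (c.tab j)
      · rw [h.act_zeroBatch_subspace hn hs (Or.inr (by rw [ha]; exact hi)), hs.eq_subKet, ha]
      · obtain ⟨a, hm⟩ := not_not.1 fun hnb => hj ⟨hnb, hs⟩
        obtain ⟨q, hq⟩ := List.mem_iff_getElem?.1 hm
        have hrow := h.row q _ hq
        rw [h.act_zeroBatch_batch hn false hm]
        dsimp only at hrow ⊢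
        rw [← ha, hrow.1, address_batchKet (by omega)]
    k_le := h.k_le
    start_le := le_rfl
    k_le_start := Nat.le_add_right _ _
    length_le := Nat.zero_le _
    cost_le := by
      obtain ⟨j, hj, hc⟩ := h.cost_le
      refine ⟨j + 1, by rw [hk, hj, add_mul, one_mul], ?_⟩
      change cost (c.circ ++ c.zeroBatch false n) ≤ _ + 0
      rw [Finset.sum_range_succ, cost_append, zeroBatch]
      split_ifs with hb
      · simp only [hb, List.length_nil] at hc
        simp only [cost_nil]
        omega
      · have hlen := h.length_le
        -- A completed block fits among the addresses: m ≤ k ≤ 2^l.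
        have hp : Nat.log 2 (n - subBits s) ≤ subBits s := by
          refine (Nat.pow_le_pow_iff_right (by norm_num : 1 < 2)).1 ?_
          change batchSize n s ≤ _
          omega
        have he : blockBits n s + Nat.log 2 (n - subBits s) = subBits s := by
          rw [blockBits]; omega
        have hj' : j < 2 ^ blockBits n s := by
          refine lt_of_mul_lt_mul_right (a := batchSize n s) ?_ (Nat.zero_le _)
          have : 2 ^ blockBits n s * batchSize n s = 2 ^ subBits s := by
            rw [batchSize, ← pow_add, he]
          have := Nat.two_pow_pos (Nat.log 2 (n - subBits s))
          change 0 < batchSize n s at this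
          omega
        have := cost_pui_block (n := n) (U := c.zeroing) (p := Nat.log 2 (n - subBits s)) hj'
        rw [he] at this
        change cost (pui false n (subBits s) (j * batchSize n s)
          (j * batchSize n s + batchSize n s) c.zeroing) = ones _ j + batchSize n s - 2 at this
        rw [← hj, ← hk] at this
        rw [this, blockCost]
        omega }

theorem Invariant.step (h : Invariant n C c) (hn : subBits s < n) {c' : AlgState s}
    (hs : Step n c c') : Invariant n C c' := by
  cases hs with
  | close hk => exact h.close hn hk
  | skip hb hk => exact h.skip hb hk
  | addSwap hb hk j hj r hr hrn hjr => exact h.addSwap hn hb hk hr hrn hjr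
  | addToffoli hb hk hno j hj u hu hju e he v hv hjv =>
    exact h.addToffoli hn hb hk hno hj hu hju he hv hjv

theorem invariant_of_reaches (hn : subBits s < n)
    (h : Relation.ReflTransGen (Step n) (initial C) c) : Invariant n C c := by
  induction h with
  | refl => exact invariant_initial C
  | tail _ hs ih => exact ih.step hn hs

/-! ### Termination and progress -/

theorem Step.measure_lt {c' : AlgState s} (hs : Step n c c') :
    c.start + c.k < c'.start + c'.k := by
  cases hs with
  | close hk =>
    have := Nat.two_pow_pos (Nat.log 2 (n - subBits s))
    change 0 < batchSize n s at this
    change c.start + c.k < c.k + c.k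
    omega
  | skip => exact Nat.lt_succ_self _
  | addSwap => exact Nat.lt_succ_self _
  | addToffoli => exact Nat.lt_succ_self _

theorem terminates (hn : subBits s < n) : ¬ ∃ r : ℕ → AlgState s,
    r 0 = initial C ∧ ∀ t, Step n (r t) (r (t + 1)) := by
  rintro ⟨r, hr, hs⟩
  have hinv : ∀ t, Invariant n C (r t) := fun t => by
    induction t with
    | zero => exact hr ▸ invariant_initial C
    | succ t ih => exact ih.step hn (hs t)
  have hmono : ∀ t, t ≤ (r t).start + (r t).k := fun t => by
    induction t with
    | zero => exact Nat.zero_le _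
    | succ t ih => have := (hs t).measure_lt; omega
  -- Each step raises `start + k`, yet `start ≤ k ≤ s` bounds it by `2 * s`.
  have h₁ := hmono (2 * s + 1)
  have h₂ := (hinv (2 * s + 1)).k_le
  have h₃ := (hinv (2 * s + 1)).start_le
  omega

theorem Invariant.exists_step_or_returns (h : Invariant n C c) (hC : Function.Injective C) :
    (∃ c', Step n c c') ∨ ∃ G f, Returns n c G f := by
  by_cases hk : c.k = c.start + batchSize n s
  · exact Or.inl ⟨_, .close c hk⟩
  by_cases hp : ∃ j, c.Pending j
  · refine Or.inl ?_
    have hb : c.Building n := ⟨hk, hp⟩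
    by_cases ho : c.Occupied
    · exact ⟨_, .skip c hb ho⟩
    by_cases hno : ∀ i, ¬ c.InBatch i → ∀ r, subBits s + c.batch.length ≤ r → r < n →
        c.tab i r = false
    · obtain ⟨j, hj⟩ := hp
      obtain ⟨u, hu, hju⟩ : ∃ u, subBits s ≤ u ∧ c.tab j u = true := by
        simpa [InSubspace] using hj.2
      have hun : u < n := by
        by_contra hun
        simp [h.zero j u (by omega)] at hju
      have hub : u - subBits s < c.batch.length := by
        by_contra hub
        simp [hno j hj.1 u (by omega) hun] at hju
      obtain ⟨v, hjv⟩ : ∃ v, c.tab j v ≠ c.tab (c.batch[u - subBits s]).1 v := by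
        -- Distinct rows stay distinct, so a row outside the batch differs somewhere from the batch
        -- row.
        refine Function.ne_iff.1 fun heq => hj.1 ?_
        rw [h.tab_injective hC heq]
        exact ⟨_, List.getElem_mem hub⟩
      have hv : v < n := by
        by_contra hv
        exact hjv (by rw [h.zero _ v (by omega), h.zero _ v (by omega)])
      exact ⟨_, .addToffoli c hb ho hno j hj u hu hju _ (List.getElem?_eq_getElem hub) v hv hjv⟩
    · push Not at hno
      obtain ⟨j, hj, r, hr, hrn, hjr⟩ := hno
      exact ⟨_, .addSwap c hb ho j hj r hr hrn (by simpa using hjr)⟩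
  · exact Or.inr ⟨_, _, hk, fun j hj => hp ⟨j, hj⟩, rfl, fun _ => rfl⟩

/-! ### The Toffoli bound -/

/-- A block's budget is `2 * m - 3 + ones e i`, except that for m = 1 and i = 0 truncation gives 0
instead of -1. Other indices have a binary one, so the extra 1 occurs at most once. -/
theorem sum_blockCost_le {m e B : ℕ} (hm : 1 ≤ m) (hB : B ≤ 2 ^ e) :
    ∑ i ∈ Finset.range B, blockCost m e i + 3 * B ≤
      2 * m * B + ∑ i ∈ Finset.range B, ones e i + 1 := by
  rcases Nat.eq_zero_or_pos B with rfl | hB0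
  · simp
  have h : ∀ i ∈ Finset.range B, blockCost m e i + 3 ≤ 2 * m + ones e i + if i = 0 then 1 else 0 :=
    fun i hi => by
      unfold blockCost
      split_ifs with h
      · omega
      · have := ones_pos (by omega) ((Finset.mem_range.1 hi).trans_le hB)
        omega
  have := Finset.sum_le_sum h
  simp only [Finset.sum_add_distrib, Finset.sum_const, Finset.card_range, smul_eq_mul,
    Finset.sum_ite_eq', Finset.mem_range, hB0, if_true] at this
  linarith

/-- The cost of the last batch. -/
theorem Invariant.cost_zeroBatch_le (h : Invariant n C c)
    (hb : c.batch ≠ []) :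
    cost (c.zeroBatch true n) ≤ c.k - c.start + subBits s - 2 := by
  have hlen := h.length_le
  have hpos := List.length_pos_iff.2 hb
  have hk' := h.k_le_start
  have hks := h.k_le.trans (le_two_pow_subBits s)
  obtain ⟨j, hj, -⟩ := h.cost_le
  rw [zeroBatch, if_neg hb]
  by_cases hp : Nat.log 2 (n - subBits s) ≤ subBits s
  · have he : blockBits n s + Nat.log 2 (n - subBits s) = subBits s := by
      rw [blockBits]; omega
    have hj' : j < 2 ^ blockBits n s := by
      refine lt_of_mul_lt_mul_right (a := batchSize n s) ?_ (Nat.zero_le _)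
      have : 2 ^ blockBits n s * batchSize n s = 2 ^ subBits s := by
        rw [batchSize, ← pow_add, he]
      omega
    have := cost_pui_partial (n := n) (U := c.zeroing) (p := Nat.log 2 (n - subBits s)) (k := c.k)
      hj' (by change j * batchSize n s < _; omega)
      (by change _ ≤ j * batchSize n s + batchSize n s; omega)
    rw [he] at this
    change cost (pui true n (subBits s) (j * batchSize n s) c.k c.zeroing) ≤
      c.k - j * batchSize n s + _ - 2 at this
    rwa [← hj] at this
  -- A block exceeds the whole tree, so the tree itself serves as the only block, with `e = 0`.
  · have hm : 2 ^ subBits s < batchSize n s :=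
      Nat.pow_lt_pow_right (by norm_num) (by omega)
    have hj0 : j = 0 := by
      by_contra hj0
      have := Nat.le_mul_of_pos_left (batchSize n s) (Nat.pos_of_ne_zero hj0)
      omega
    have hs0 : c.start = 0 := by rw [hj, hj0, zero_mul]
    have := cost_pui_partial (n := n) (U := c.zeroing) (p := subBits s) (e := 0) (j := 0)
      (k := c.k) (by norm_num) (by omega) (by omega)
    simpa [hs0] using this

/-- As the block is not exhausted, `k - start ≤ m - 1`, so the last iteration costs at most (m - 2)
+ (l - 1). A nonempty batch forces `start < k ≤ s`, so its block is among the first `B`. -/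
theorem Invariant.cost_le_of_log_le (h : Invariant n C c) (hs : 2 ≤ s)
    (hk : c.k ≠ c.start + batchSize n s) {B : ℕ} (hB : s ≤ B * batchSize n s) :
    cost (c.append (c.zeroBatch true n)).circ ≤
      ∑ i ∈ Finset.range B, blockCost (batchSize n s) (blockBits n s) i + (subBits s - 1) := by
  have hlen := h.length_le
  have hk' := h.k_le_start
  have hst := h.start_le
  have hks := h.k_le
  have hm : 0 < batchSize n s := Nat.two_pow_pos _
  have hl : 0 < subBits s := Nat.clog_pos (by norm_num) hs
  obtain ⟨j, hj, hc⟩ := h.cost_le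
  have hcost := h.cost_zeroBatch_le
  change cost (c.circ ++ c.zeroBatch true n) ≤ _
  rw [cost_append]
  by_cases hb : c.batch = []
  · have hjB : j ≤ B := le_of_mul_le_mul_right (a := batchSize n s) (by omega) hm
    have := Finset.sum_le_sum_of_subset (f := blockCost (batchSize n s) (blockBits n s))
      (Finset.range_mono hjB)
    rw [hb] at hc
    rw [zeroBatch, if_pos hb, cost_nil]
    simp only [List.length_nil] at hc
    omega
  · have hpos := List.length_pos_iff.2 hb
    have hcost := hcost hb
    have hjB : j < B := lt_of_mul_lt_mul_right (a := batchSize n s) (by omega) hm.le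
    have := Finset.sum_le_sum_of_subset (f := blockCost (batchSize n s) (blockBits n s))
      (Finset.range_mono (show j + 1 ≤ B from hjB))
    rw [Finset.sum_range_succ, blockCost] at this
    omega

theorem Invariant.cost_le_of_lt_log (h : Invariant n C c) (hs : 2 ≤ s)
    (hm : 2 ^ subBits s < batchSize n s) :
    cost (c.append (c.zeroBatch true n)).circ + 3 ≤ 2 * 2 ^ subBits s + subBits s := by
  have hlen := h.length_le
  have hst := h.start_le
  have hks := h.k_le.trans (le_two_pow_subBits s)
  have hs' := le_two_pow_subBits s
  have hl : 0 < subBits s := Nat.clog_pos (by norm_num) hs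
  obtain ⟨j, hj, hc⟩ := h.cost_le
  have hcost := h.cost_zeroBatch_le
  obtain rfl : j = 0 := by
    by_contra hj0
    have := Nat.le_mul_of_pos_left (batchSize n s) (Nat.pos_of_ne_zero hj0)
    omega
  rw [Finset.range_zero, Finset.sum_empty] at hc
  change cost (c.circ ++ c.zeroBatch true n) + 3 ≤ _
  rw [cost_append]
  by_cases hb : c.batch = []
  · rw [hb] at hc
    rw [zeroBatch, if_pos hb, cost_nil]
    simp only [List.length_nil] at hc
    omega
  · have hpos := List.length_pos_iff.2 hb
    have hcost := hcost hb
    omega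

theorem Invariant.cost_bound (h : Invariant n C c) (hs : 2 ≤ s)
    (hk : c.k ≠ c.start + batchSize n s) :
    (cost (c.append (c.zeroBatch true n)).circ : ℝ) ≤
      (⌈(s : ℝ) / (batchSize n s : ℝ)⌉₊ : ℝ) * (2 * (batchSize n s : ℝ) +
          Real.logb 2 ((2 : ℝ) ^ subBits s / (batchSize n s : ℝ)) / 2 - 3) +
        Real.logb 2 (((2 : ℝ) ^ subBits s) ^ 2 / (batchSize n s : ℝ)) := by
  set l := subBits s with hl
  set p := Nat.log 2 (n - l) with hp
  have hm : batchSize n s = 2 ^ p := rfl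
  have hmR : (batchSize n s : ℝ) = 2 ^ p := by rw [hm]; push_cast; rfl
  have hlog : ∀ k : ℕ, Real.logb 2 ((2 : ℝ) ^ k) = k := fun k => by
    rw [Real.logb_pow, Real.logb_self_eq_one (by norm_num), mul_one]
  have h₁ : Real.logb 2 ((2 : ℝ) ^ l / (batchSize n s : ℝ)) = l - p := by
    rw [hmR, Real.logb_div (by positivity) (by positivity), hlog, hlog]
  have h₂ : Real.logb 2 (((2 : ℝ) ^ l) ^ 2 / (batchSize n s : ℝ)) = 2 * l - p := by
    rw [hmR, Real.logb_div (by positivity) (by positivity), ← pow_mul, hlog, hlog]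
    push_cast; ring
  have hl0 : 1 ≤ l := Nat.clog_pos (by norm_num) hs
  have hsl : s ≤ 2 ^ l := le_two_pow_subBits s
  rw [h₁, h₂]
  set B := ⌈(s : ℝ) / (batchSize n s : ℝ)⌉₊ with hB
  have hmpos : (0 : ℝ) < batchSize n s := by rw [hmR]; positivity
  by_cases hpl : p ≤ l
  · have hsB : s ≤ B * batchSize n s := by
      have := (div_le_iff₀ hmpos).1 (Nat.le_ceil ((s : ℝ) / (batchSize n s : ℝ)))
      exact_mod_cast this
    have he : blockBits n s + p = l := Nat.sub_add_cancel hpl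
    have hB2 : B ≤ 2 ^ blockBits n s := by
      rw [hB, Nat.ceil_le, div_le_iff₀ hmpos]
      have : s ≤ 2 ^ blockBits n s * batchSize n s := by rwa [hm, ← pow_add, he]
      exact_mod_cast this
    have hc := h.cost_le_of_log_le hs hk hsB
    have hb := sum_blockCost_le (m := batchSize n s) (Nat.two_pow_pos _) hB2
    have ho := two_mul_sum_ones_le hB2
    have heR : (blockBits n s : ℝ) = l - p := by rw [← he]; push_cast; ring
    have hc' : cost (c.append (c.zeroBatch true n)).circ + 1 ≤
        ∑ i ∈ Finset.range B, blockCost (batchSize n s) (blockBits n s) i + l := by omega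
    have hcR : (cost (c.append (c.zeroBatch true n)).circ : ℝ) + 1 ≤
        ((∑ i ∈ Finset.range B, blockCost (batchSize n s) (blockBits n s) i : ℕ) : ℝ) + l := by
      exact_mod_cast hc'
    have hbR : ((∑ i ∈ Finset.range B, blockCost (batchSize n s) (blockBits n s) i : ℕ) : ℝ) +
        3 * B ≤ 2 * batchSize n s * B + ((∑ i ∈ Finset.range B, ones (blockBits n s) i : ℕ) : ℝ) +
          1 := by
      exact_mod_cast hb
    have hoR : 2 * ((∑ i ∈ Finset.range B, ones (blockBits n s) i : ℕ) : ℝ) ≤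
        B * (blockBits n s : ℝ) := by
      exact_mod_cast ho
    have hplR : (p : ℝ) ≤ l := by exact_mod_cast hpl
    rw [heR] at hoR
    nlinarith
  · have hlt : 2 ^ l < batchSize n s := Nat.pow_lt_pow_right (by norm_num) (not_le.1 hpl)
    have hB1 : B = 1 := by
      refine le_antisymm (Nat.ceil_le.2 ?_) (Nat.ceil_pos.2 (by positivity))
      rw [div_le_iff₀ hmpos, Nat.cast_one, one_mul]
      exact_mod_cast hsl.trans hlt.le
    -- With p = l + d the claimed bound is 2·2^l·2^d - 3 + l - 3d/2. Since 2^d ≥ d + 1 and 2^l ≥ 2,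
    -- the factor 2^d outweighs the negative logarithms.
    obtain ⟨d, hd⟩ := Nat.exists_eq_add_of_le (not_le.1 hpl).le
    have hc := h.cost_le_of_lt_log hs hlt
    have hd' : d + 1 ≤ 2 ^ d := Nat.lt_two_pow_self
    have hl2 : 2 ≤ 2 ^ l := (Nat.pow_le_pow_right (by norm_num) hl0 : 2 ^ 1 ≤ 2 ^ l)
    have hcR : (cost (c.append (c.zeroBatch true n)).circ : ℝ) + 3 ≤ 2 * 2 ^ l + l := by
      exact_mod_cast hc
    have hdR : (d : ℝ) + 1 ≤ 2 ^ d := by exact_mod_cast hd'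
    have hlR : (2 : ℝ) ≤ 2 ^ l := by exact_mod_cast hl2
    have hd0 : (0 : ℝ) ≤ d := Nat.cast_nonneg d
    rw [hB1, hmR, hd, pow_add]
    push_cast
    nlinarith [mul_le_mul hlR hdR (by positivity) (by positivity)]

theorem Invariant.row_of_returns (h : Invariant n C c) (hn : subBits s < n)
    (hp : ∀ j, ¬ c.Pending j) (j : Fin s) :
    act (c.zeroBatch true n) (c.tab j) =
      subKet (subBits s) (address (subBits s) (act (c.zeroBatch true n) (c.tab j))) := by
  by_cases hs : InSubspace (subBits s) (c.tab j)
  · rw [h.act_zeroBatch_subspace hn hs (Or.inl rfl), ← hs.eq_subKet]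
  · obtain ⟨a, hm⟩ := not_not.1 fun hnb => hp j ⟨hnb, hs⟩
    have := h.act_zeroBatch_batch hn true hm
    dsimp only at this
    rw [this]
    exact (inSubspace_subKet _ _).eq_subKet

end AlgState
end SparseIso

/-! ### The main theorem -/

open SparseIso in
theorem mainTheorem1 (n s : ℕ) (hs : 2 ≤ s) (hn : Nat.clog 2 s < n)
    (C : Fin s → Fin n → Bool) (hC : Function.Injective C) :
    -- the algorithm terminates, whatever choices it makes
    (¬ ∃ r : ℕ → AlgState s,
      r 0 = AlgState.initial C ∧ ∀ t, AlgState.Step n (r t) (r (t + 1))) ∧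
    ∀ c : AlgState s, Relation.ReflTransGen (AlgState.Step n) (AlgState.initial C) c →
      -- the algorithm never gets stuck
      ((∃ c', AlgState.Step n c c') ∨ ∃ G f, AlgState.Returns n c G f) ∧
      ∀ (G : Circuit) (f : Fin s → ℕ), AlgState.Returns n c G f →
        -- `f` is a bijection onto a subset of `[2 ^ ⌈log s⌉]`
        Function.Injective f ∧ (∀ i, f i < 2 ^ Nat.clog 2 s) ∧
        -- `G` is a circuit on `n` system qubits and `⌈log s⌉ - 1` ancillas
        (∀ g ∈ G, g.WellFormed ∧ ∀ q ∈ g.wires, q < n + (Nat.clog 2 s - 1)) ∧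
        -- `G` maps `|C_i⟩` to `|f(i)⟩|0⟩`
        (∀ (o : ℕ → Bool) (i : Fin s), run G o (ket (extend (C i))) =
          (((Real.sqrt 2)⁻¹ : ℝ) : ℂ) ^ measurements G • ket (subKet (Nat.clog 2 s) (f i))) ∧
        -- the inverse circuit maps the dense state to the target state
        (∀ (o : ℕ → Bool) (a : Fin s → ℂ),
          run (inverse G) o (∑ i, a i • ket (subKet (Nat.clog 2 s) (f i))) =
            (((Real.sqrt 2)⁻¹ : ℝ) : ℂ) ^ measurements (inverse G) •
              ∑ i, a i • ket (extend (C i))) ∧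
        -- the Toffoli count of the inverse circuit
        (toffolis (inverse G) : ℝ) ≤
          (⌈(s : ℝ) / (batchSize n s : ℝ)⌉₊ : ℝ) *
              (2 * (batchSize n s : ℝ) +
                Real.logb 2 ((2 : ℝ) ^ Nat.clog 2 s / (batchSize n s : ℝ)) / 2 - 3) +
            Real.logb 2 (((2 : ℝ) ^ Nat.clog 2 s) ^ 2 / (batchSize n s : ℝ)) := by
  refine ⟨AlgState.terminates hn, fun c hc => ?_⟩
  have hinv := AlgState.invariant_of_reaches hn hc
  refine ⟨hinv.exists_step_or_returns hC, ?_⟩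
  rintro G f ⟨hk, hp, rfl, hf⟩
  have hS := hinv.append_zeroBatch hn true
  have hact : ∀ i, act (c.append (c.zeroBatch true n)).circ (extend (C i)) =
      subKet (Nat.clog 2 s) (f i) := fun i => by
    rw [← hS.tab_eq, hf]
    exact hinv.row_of_returns hn hp i
  refine ⟨fun i j hij => ?_, fun i => ?_, hS.wires, fun o i => ?_, fun o a => ?_,
    hinv.cost_bound hs hk⟩
  · refine hC (extend_injective n ((hS.valid i).act_injective (hS.valid j) ?_))
    rw [hact, hact, hij]
  · rw [hf]
    exact address_lt _ _
  · rw [(hS.valid i).run_ket, hact]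
  · rw [map_sum, Finset.smul_sum]
    refine Finset.sum_congr rfl fun i _ => ?_
    have hi := (hS.valid i).inverse
    rw [hact] at hi
    rw [map_smul, hi.1.run_ket, hi.2, smul_comm]
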